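/- Fix $\alpha>0$. For each integer $N\ge 1$ let $M=\lfloor N^{1+\alpha}\rfloor$ and consider a continuous-time Markov process $(\eta(1,t),\dots,\eta(N,t),n_-(t),n_+(t))_{t\ge 0}$ on $\{0,1\}^{N}\times\{0,\dots,M\}\times\{0,\dots,M\}$ with the following dynamics: for each $1\le x\le N-1$ the values $\eta(x)$ and $\eta(x+1)$ are exchanged at rate $\tfrac12$; at rate $\tfrac12(1-\tfrac{n_+}{M})\eta(N)+\tfrac12\tfrac{n_+}{M}(1-\eta(N))$ the site $N$ exchanges a particle with the right reservoir, that is, if $\eta(N)=1$ then $\eta(N)$ becomes $0$ and $n_+$ becomes $n_++1$, and if $\eta(N)=0$ then $\eta(N)$ becomes $1$ and $n_+$ becomes $n_+-1$; and in the same way the site $1$ exchanges particles with the left reservoir, with $n_-$ and $\eta(1)$ in place of $n_+$ and $\eta(N)$. Put $\rho^N(x,t)=\mathbf E[\eta(x,t)]$ for $0\le x\le N+1$, where $\eta(0,t):=n_-(t)/M$ and $\eta(N+1,t):=n_+(t)/M$, and write $\rho^N_-(t)=\rho^N(0,t)$, $\rho^N_+(t)=\rho^N(N+1,t)$. Let $u_0$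 be continuous on $(0,1)$ with values in $[0,1]$, with some value assigned at the point $1$, and let $v_{0,\pm}\in[0,1]$. Suppose that at time $0$, $n_\pm(0)/M\to v_{0,\pm}$ in probability as $N\to\infty$, and $\rho^N(x,0)=u_0(x/N)$ for all $N\ge 1$ and $1\le x\le N$. Then: a) The problem $$u_t=\tfrac12 u_{rr}\ \text{ on } [0,1]\times(0,\infty),\qquad u(0,t)=v_{0,-},\quad u(1,t)=v_{0,+}\ \ (t>0),\qquad \lim_{t\downarrow 0}u(r,t)=u_0(r)\ \ (0<r<1)$$ has exactly one bounded classical solution $u$ (that is, $u$, $u_t$ and $u_{rr}$ exist and are continuous on $[0,1]\times(0,\infty)$, with one-sided $r$-derivatives at $r=0,1$), and for all $r\in[0,1]$ and $t>0$, as $N\to\infty$, $$\rho^N(\lfloor Nr\rfloor,N^2t)\to u(r,t),\qquad \rho^N_\pm(N^2t)\to v_{0,\pm}.$$ b) For all $\alpha'\in(0,\alpha)$, $r\in[0,1]$ and $t>0$, as $N\to\infty$, $$\rho^N(\lfloor Nr\rfloor,N^{2+\alpha'}t)\to (v_{0,+}-v_{0,-})\,r+v_{0,-},\qquad \rho^N_\pm(N^{2+\alpha'}t)\to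 v_{0,\pm}.$$ -/

import Mathlib

open MeasureTheory Filter Topology
open scoped NNReal

noncomputable section

namespace Channel

/-! ### Continuous-time Markov processes on a finite state space -/

/-- The semigroup `exp (t L)` on functions generated by a linear operator `L`. -/
def semigroup {S : Type*} [Fintype S] (L : (S → ℝ) →ₗ[ℝ] (S → ℝ)) (t : ℝ≥0) :
    (S → ℝ) →L[ℝ] (S → ℝ) :=
  NormedSpace.exp ((t : ℝ) • LinearMap.toContinuousLinearMap L)

/-- `X` is, under `P`, a Markov process (with respect to its own past) with generator `L`:
`E[f(X_{s+t}) | X_u, u ≤ s] = (exp (t L) f)(X_s)` almost surely. The initial law is free. -/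
structure IsMarkovProcess {S : Type*} [Fintype S] [MeasurableSpace S]
    (L : (S → ℝ) →ₗ[ℝ] (S → ℝ)) {Ω : Type*} [MeasurableSpace Ω] (P : Measure Ω)
    (X : ℝ≥0 → Ω → S) : Prop where
  measurable : ∀ t, Measurable (X t)
  markov : ∀ (s t : ℝ≥0) (f : S → ℝ),
    P[fun ω => f (X (s + t) ω) | ⨆ u : Set.Iic s, MeasurableSpace.comap (X u) inferInstance]
      =ᵐ[P] fun ω => semigroup L t f (X s ω)

/-! ### The particle system: a channel of `N` sites and two reservoirs of size `M` -/

/-- States `(η, n₋, n₊)`. The index `i : Fin N` is the site `i + 1` of the channel `{1, …, N}`. -/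
abbrev State (N M : ℕ) : Type := (Fin N → Bool) × Fin (M + 1) × Fin (M + 1)

/-- The number of particles, `0` or `1`, as a real number. -/
def occ (b : Bool) : ℝ := if b then 1 else 0

/-- The rate at which a boundary site with occupation `b` exchanges a particle with a reservoir
of size `M` holding `n` particles. -/
def boundaryRate {M : ℕ} (n : Fin (M + 1)) (b : Bool) : ℝ :=
  1 / 2 * (1 - (n : ℝ) / M) * occ b + 1 / 2 * ((n : ℝ) / M) * (1 - occ b)

/-- New number of particles in a reservoir after an exchange with a site with occupation `b`:
`n + 1` if the site gives its particle (`b = 1`), `n - 1` if it receives one (`b = 0`).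
The truncations at `M` and at `0` only matter where `boundaryRate` vanishes. -/
def reservoirUpdate {M : ℕ} (n : Fin (M + 1)) (b : Bool) : Fin (M + 1) :=
  if b then ⟨min (n + 1) M, by omega⟩ else ⟨n - 1, by omega⟩

/-- Exchange of the occupations of two channel sites. -/
def exchange {N M : ℕ} (i j : Fin N) (w : State N M) : State N M :=
  (w.1 ∘ Equiv.swap i j, w.2)

/-- Exchange of a particle between the site `i` and the left reservoir. -/
def flipLeft {N M : ℕ} (i : Fin N) (w : State N M) : State N M :=
  (Function.update w.1 i (!w.1 i), reservoirUpdate w.2.1 (w.1 i), w.2.2)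

/-- Exchange of a particle between the site `i` and the right reservoir. -/
def flipRight {N M : ℕ} (i : Fin N) (w : State N M) : State N M :=
  (Function.update w.1 i (!w.1 i), w.2.1, reservoirUpdate w.2.2 (w.1 i))

/-- The generator of the process: stirring at rate `1/2` over each bond of the channel, and
exchange of the first (last) site with the left (right) reservoir. -/
def generator (N M : ℕ) : (State N M → ℝ) →ₗ[ℝ] (State N M → ℝ) where
  toFun f w :=
    1 / 2 * (∑ i : Fin N, ∑ j : Fin N,
        if (i : ℕ) + 1 = j then f (exchange i j w) - f w else 0)
      + (∑ i : Fin N, if (i : ℕ) + 1 = N then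
          boundaryRate w.2.2 (w.1 i) * (f (flipRight i w) - f w) else 0)
      + (∑ i : Fin N, if (i : ℕ) = 0 then
          boundaryRate w.2.1 (w.1 i) * (f (flipLeft i w) - f w) else 0)
  map_add' f g := by
    funext w
    have h : ∀ (p : Prop) [Decidable p] (c a b a' b' : ℝ),
        (if p then c * (a + b - (a' + b')) else 0)
          = (if p then c * (a - a') else 0) + (if p then c * (b - b') else 0) := by
      intro p _ c a b a' b'
      split_ifs <;> ring
    have h₁ : ∀ (p : Prop) [Decidable p] (a b a' b' : ℝ),
        (if p then a + b - (a' + b') else 0)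
          = (if p then a - a' else 0) + (if p then b - b' else 0) := by
      intro p _ a b a' b'
      split_ifs <;> ring
    simp only [Pi.add_apply, h, h₁, Finset.sum_add_distrib]
    ring
  map_smul' c f := by
    funext w
    simp only [Pi.smul_apply, smul_eq_mul, RingHom.id_apply, mul_add, Finset.mul_sum]
    congr 1
    · congr 1
      · refine Finset.sum_congr rfl fun i _ => Finset.sum_congr rfl fun j _ => ?_
        split_ifs <;> ring
      · refine Finset.sum_congr rfl fun i _ => ?_
        split_ifs <;> ring
    · refine Finset.sum_congr rfl fun i _ => ?_
      split_ifs <;> ring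

/-- The value `η(x)`, `0 ≤ x ≤ N + 1`, with `η(0) = n₋ / M` and `η(N + 1) = n₊ / M`. -/
def eta {N M : ℕ} (w : State N M) (x : ℕ) : ℝ :=
  if x = 0 then (w.2.1 : ℝ) / M
  else if h : x - 1 < N then occ (w.1 ⟨x - 1, h⟩)
  else (w.2.2 : ℝ) / M

/-- The density `ρ(x, t) = E[η(x, t)]`, `0 ≤ x ≤ N + 1`. -/
def rho {N M : ℕ} {Ω : Type*} [MeasurableSpace Ω] (P : Measure Ω)
    (X : ℝ≥0 → Ω → State N M) (x : ℕ) (t : ℝ≥0) : ℝ :=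
  ∫ ω, eta (X t ω) x ∂P

/-- The size of each reservoir, `N ^ (1 + α)` (its integer part). -/
def reservoirSize (α : ℝ) (N : ℕ) : ℕ := ⌊(N : ℝ) ^ (1 + α)⌋₊

/-! ### The limit equation -/

/-- `u` is a bounded classical solution of `u_t = u_rr / 2` on `[0,1] × (0,∞)` with boundary values
`vMinus` at `r = 0` and `vPlus` at `r = 1`, and `u(r,t) → u₀(r)` as `t ↓ 0` for `0 < r < 1`. -/
structure IsHeatSolution (u₀ : ℝ → ℝ) (vMinus vPlus : ℝ) (u : ℝ → ℝ → ℝ) : Prop where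
  bounded : ∃ C : ℝ, ∀ r ∈ Set.Icc (0 : ℝ) 1, ∀ t > 0, |u r t| ≤ C
  continuousOn : ContinuousOn (Function.uncurry u) (Set.Icc 0 1 ×ˢ Set.Ioi 0)
  equation : ∃ ur urr : ℝ → ℝ → ℝ,
    ContinuousOn (Function.uncurry urr) (Set.Icc 0 1 ×ˢ Set.Ioi 0) ∧
    ∀ r ∈ Set.Icc (0 : ℝ) 1, ∀ t > 0,
      HasDerivWithinAt (fun x => u x t) (ur r t) (Set.Icc 0 1) r ∧
      HasDerivWithinAt (fun x => ur x t) (urr r t) (Set.Icc 0 1) r ∧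
      HasDerivAt (fun s => u r s) (1 / 2 * urr r t) t
  left_boundary : ∀ t > 0, u 0 t = vMinus
  right_boundary : ∀ t > 0, u 1 t = vPlus
  initial : ∀ r ∈ Set.Ioo (0 : ℝ) 1, Tendsto (fun t => u r t) (𝓝[>] 0) (𝓝 (u₀ r))

end Channel

end

namespace Channel

/-! ### The closed system of equations for the densities -/

/-- The densities `R x t`, `0 ≤ x ≤ N + 1`, solve the discrete heat equation in the channel
`{1, …, N}`, and the reservoirs at `0` and `N + 1`, of capacity `M`, absorb the boundary currents. -/
structure DensitySystem (N : ℕ) (M : ℝ) (R : ℕ → ℝ → ℝ) : Prop where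
  interior : ∀ x < N, ∀ t,
    HasDerivAt (R (x + 1)) (1 / 2 * (R (x + 2) t + R x t - 2 * R (x + 1) t)) t
  left : ∀ t, HasDerivAt (R 0) ((R 1 t - R 0 t) / (2 * M)) t
  right : ∀ t, HasDerivAt (R (N + 1)) ((R N t - R (N + 1) t) / (2 * M)) t
  mem_Icc : ∀ x, ∀ t ≥ 0, R x t ∈ Set.Icc (0 : ℝ) 1

/-- Left derivatives are nonnegative at a maximum. -/
theorem deriv_nonneg_of_isMaxOn_Icc {h : ℝ → ℝ} {d s T : ℝ} (hs : 0 < s) (hsT : s ≤ T)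
    (hd : HasDerivAt h d s) (hmax : IsMaxOn h (Set.Icc 0 T) s) : 0 ≤ d := by
  have hseg : segment ℝ s 0 ⊆ Set.Icc 0 T := by
    rw [segment_symm, segment_eq_Icc hs.le]
    exact Set.Icc_subset_Icc_right hsT
  have key := (hmax.localize).hasFDerivWithinAt_nonpos hd.hasFDerivAt.hasFDerivWithinAt
    (sub_mem_posTangentConeAt_of_segment_subset hseg)
  simp at key
  nlinarith

/-- Comparison principle for the discrete heat equation. -/
theorem discrete_heat_nonpos {N : ℕ} {T : ℝ} {g : ℕ → ℝ → ℝ}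
    (hg : ∀ x < N, ∀ t,
      HasDerivAt (g (x + 1)) (1 / 2 * (g (x + 2) t + g x t - 2 * g (x + 1) t)) t)
    (hinit : ∀ x < N, g (x + 1) 0 ≤ 0)
    (hleft : ∀ t ∈ Set.Icc 0 T, g 0 t ≤ 0) (hright : ∀ t ∈ Set.Icc 0 T, g (N + 1) t ≤ 0) :
    ∀ x ≤ N + 1, ∀ t ∈ Set.Icc 0 T, g x t ≤ 0 := by
  have main : ∀ x < N, ∀ t ∈ Set.Icc 0 T, g (x + 1) t ≤ 0 := by
    by_contra! hcon
    obtain ⟨x₀, hx₀, t₀, ht₀, hpos⟩ := hcon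
    obtain ⟨e, he, hpos'⟩ : ∃ e > 0, 0 < g (x₀ + 1) t₀ - e * t₀ := by
      refine ⟨g (x₀ + 1) t₀ / (t₀ + 1), div_pos hpos (by linarith [ht₀.1]), ?_⟩
      have h1 : 0 < t₀ + 1 := by linarith [ht₀.1]
      have : g (x₀ + 1) t₀ - g (x₀ + 1) t₀ / (t₀ + 1) * t₀ = g (x₀ + 1) t₀ / (t₀ + 1) := by
        field_simp; ring
      rw [this]; positivity
    have hne : (Set.Icc 0 T).Nonempty := ⟨t₀, ht₀⟩
    have hder : ∀ x < N, ∀ t, HasDerivAt (fun s => g (x + 1) s - e * s)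
        (1 / 2 * (g (x + 2) t + g x t - 2 * g (x + 1) t) - e) t := fun x hx t => by
      simpa using (hg x hx t).fun_sub ((hasDerivAt_id t).const_mul e)
    have hmax : ∀ x, ∃ s ∈ Set.Icc 0 T, x < N →
        IsMaxOn (fun s => g (x + 1) s - e * s) (Set.Icc 0 T) s := fun x => by
      by_cases hx : x < N
      · obtain ⟨s, hs, hs'⟩ := isCompact_Icc.exists_isMaxOn hne
          (fun t _ => (hder x hx t).continuousAt.continuousWithinAt)
        exact ⟨s, hs, fun _ => hs'⟩
      · exact ⟨t₀, ht₀, fun h => absurd h hx⟩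
    choose s hs hsmax using hmax
    obtain ⟨x, hx, hxmax⟩ := Finset.exists_max_image (Finset.range N)
      (fun x => g (x + 1) (s x) - e * s x) ⟨x₀, Finset.mem_range.2 hx₀⟩
    rw [Finset.mem_range] at hx
    have hall : ∀ y < N, ∀ t ∈ Set.Icc 0 T, g (y + 1) t - e * t ≤ g (x + 1) (s x) - e * s x :=
      fun y hy t ht => (hsmax y hy ht).trans (hxmax y (Finset.mem_range.2 hy))
    have hval : 0 < g (x + 1) (s x) - e * s x := hpos'.trans_le (hall x₀ hx₀ t₀ ht₀)
    have hs0 : 0 < s x := by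
      rcases (hs x).1.eq_or_lt with h | h
      · rw [← h] at hval; linarith [hinit x hx]
      · exact h
    have hgpos : 0 < g (x + 1) (s x) := by nlinarith
    have hup : g (x + 2) (s x) ≤ g (x + 1) (s x) := by
      by_cases h : x + 1 < N
      · linarith [hall (x + 1) h (s x) (hs x)]
      · obtain rfl : N = x + 1 := by omega
        exact (hright _ (hs x)).trans hgpos.le
    have hdown : g x (s x) ≤ g (x + 1) (s x) := by
      rcases x with _ | x
      · exact (hleft _ (hs 0)).trans hgpos.le
      · linarith [hall x (by omega) (s (x + 1)) (hs (x + 1))]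
    have := deriv_nonneg_of_isMaxOn_Icc hs0 (hs x).2 (hder x hx (s x)) (hsmax x hx)
    linarith
  intro x hx t ht
  rcases x with _ | x
  · exact hleft t ht
  · rcases (Nat.le_of_succ_le_succ hx).eq_or_lt with rfl | h
    · exact hright t ht
    · exact main x h t ht

namespace DensitySystem

variable {N : ℕ} {M : ℝ} {R : ℕ → ℝ → ℝ}

theorem reflect (h : DensitySystem N M R) : DensitySystem N M (fun x => R (N + 1 - x)) where
  interior x hx t := by
    obtain ⟨y, rfl⟩ : ∃ y, N = x + y + 1 := ⟨N - x - 1, by omega⟩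
    have := h.interior y (by omega) t
    rw [show x + y + 1 + 1 - (x + 1) = y + 1 by omega, show x + y + 1 + 1 - (x + 2) = y by omega,
      show x + y + 1 + 1 - x = y + 2 by omega]
    convert this using 1
    ring
  left t := by simpa using h.right t
  right t := by
    simpa using h.left t
  mem_Icc x t ht := h.mem_Icc _ t ht

theorem sum_mul_laplacian (r : ℕ → ℝ) (n : ℕ) :
    ∑ x ∈ Finset.range n, ((x : ℝ) + 1) * (r (x + 2) + r x - 2 * r (x + 1))
      = n * r (n + 1) - (n + 1) * r n + r 0 := by
  induction n with
  | zero => simp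
  | succ n ih => rw [Finset.sum_range_succ, ih]; push_cast; ring

/-- The first moment of the density is conserved up to a current of order `1 / N`. -/
theorem abs_right_sub_le (h : DensitySystem N M R) (hM : 0 < M) {s : ℝ} (hs : 0 ≤ s) :
    |R (N + 1) s - R (N + 1) 0| ≤ (N + s / (2 * (N + 1))) / M := by
  set Q : ℝ → ℝ := fun t => ∑ x ∈ Finset.range N, ((x : ℝ) + 1) * R (x + 1) t with hQ
  have hder : ∀ t, HasDerivAt (fun t => Q t + (N + 1) * M * R (N + 1) t)
      (1 / 2 * (R 0 t - R (N + 1) t)) t := by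
    intro t
    have h1 : HasDerivAt Q (∑ x ∈ Finset.range N,
        ((x : ℝ) + 1) * (1 / 2 * (R (x + 2) t + R x t - 2 * R (x + 1) t))) t :=
      HasDerivAt.fun_sum fun x hx =>
        (h.interior x (Finset.mem_range.1 hx) t).const_mul _
    have h2 : ∑ x ∈ Finset.range N,
        ((x : ℝ) + 1) * (1 / 2 * (R (x + 2) t + R x t - 2 * R (x + 1) t))
        = 1 / 2 * (N * R (N + 1) t - (N + 1) * R N t + R 0 t) := by
      rw [← sum_mul_laplacian (fun x => R x t) N, Finset.mul_sum]
      exact Finset.sum_congr rfl fun x _ => by ring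
    rw [h2] at h1
    refine (h1.fun_add ((h.right t).const_mul ((N + 1) * M))).congr_deriv ?_
    field_simp
    ring
  have hlip := Convex.norm_image_sub_le_of_norm_hasDerivWithin_le (C := 1 / 2)
    (fun t _ => (hder t).hasDerivWithinAt) (fun t ht => by
      have h0 := h.mem_Icc 0 t ht
      have h1 := h.mem_Icc (N + 1) t ht
      rw [Real.norm_eq_abs, abs_le]
      constructor <;> linarith [h0.1, h0.2, h1.1, h1.2])
    (convex_Ici 0) (Set.mem_Ici.2 le_rfl) (Set.mem_Ici.2 hs)
  have hQm : ∀ t ≥ 0, 0 ≤ Q t ∧ Q t ≤ N * (N + 1) := by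
    intro t ht
    refine ⟨Finset.sum_nonneg fun x _ => mul_nonneg (by positivity) (h.mem_Icc _ t ht).1, ?_⟩
    calc Q t ≤ ∑ x ∈ Finset.range N, ((N : ℝ) + 1) := by
          refine Finset.sum_le_sum fun x hx => ?_
          have hx' : (x : ℝ) + 1 ≤ N := by exact_mod_cast Finset.mem_range.1 hx
          have h1 := h.mem_Icc (x + 1) t ht
          have : 0 ≤ (x : ℝ) + 1 := by positivity
          nlinarith [h1.1, h1.2]
      _ = N * (N + 1) := by simp [mul_add]
  obtain ⟨a0, a1⟩ := hQm 0 le_rfl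
  obtain ⟨b0, b1⟩ := hQm s hs
  rw [sub_zero, Real.norm_eq_abs, Real.norm_eq_abs, abs_of_nonneg hs, abs_le] at hlip
  have hN : (0 : ℝ) < N + 1 := by positivity
  have hgoal : (N + s / (2 * (N + 1))) / M = (N * (N + 1) + 1 / 2 * s) / ((N + 1) * M) := by
    field_simp
  have hpos : 0 < (N + 1) * M := by positivity
  rw [hgoal, abs_le, ← neg_div, div_le_iff₀ hpos, le_div_iff₀ hpos]
  constructor <;> linarith [hlip.1, hlip.2]

theorem abs_left_sub_le (h : DensitySystem N M R) (hM : 0 < M) {s : ℝ} (hs : 0 ≤ s) :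
    |R 0 s - R 0 0| ≤ (N + s / (2 * (N + 1))) / M := by
  simpa using h.reflect.abs_right_sub_le hM hs

/-- Upper barrier: a quadratic solution of the discrete heat equation. -/
theorem le_of_le_near (h : DensitySystem N M R) {a δ r : ℝ} (ha : 0 ≤ a) (hN : 0 < N)
    (hδ : 0 < δ) (hδr : δ ≤ r) (hδr' : δ ≤ 1 - r)
    (hinit : ∀ x < N, |((x : ℝ) + 1) / N - r| < δ → R (x + 1) 0 ≤ a)
    {x : ℕ} (hx : x ≤ N + 1) {s : ℝ} (hs : 0 ≤ s) :
    R x s ≤ a + (((x : ℝ) / N - r) ^ 2 + s / N ^ 2) / δ ^ 2 := by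
  have hN' : (0 : ℝ) < N := by exact_mod_cast hN
  have far : ∀ (z s : ℝ), δ ≤ |z| → 0 ≤ s → 1 ≤ (z ^ 2 + s / N ^ 2) / δ ^ 2 := by
    intro z s hz hs
    rw [le_div_iff₀ (by positivity), one_mul]
    have : δ ^ 2 ≤ z ^ 2 := by rw [← sq_abs z]; gcongr
    have : 0 ≤ s / (N : ℝ) ^ 2 := by positivity
    linarith
  have key := discrete_heat_nonpos (N := N) (T := s)
    (g := fun x t => R x t - (a + (((x : ℝ) / N - r) ^ 2 + t / N ^ 2) / δ ^ 2)) ?_ ?_ ?_ ?_ x hx s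
    ⟨hs, le_rfl⟩
  · simpa using key
  · intro y hy t
    have h1 : HasDerivAt (fun t : ℝ =>
        a + ((((y + 1 : ℕ) : ℝ) / N - r) ^ 2 + t / (N : ℝ) ^ 2) / δ ^ 2)
        (1 / (N : ℝ) ^ 2 / δ ^ 2) t :=
      ((((hasDerivAt_id t).div_const _).const_add _).div_const _).const_add _
    refine ((h.interior y hy t).fun_sub h1).congr_deriv ?_
    push_cast
    field_simp
    ring
  · intro y hy
    simp only [sub_nonpos]
    push_cast
    by_cases hc : |((y : ℝ) + 1) / N - r| < δ
    · refine (hinit y hy hc).trans (le_add_of_nonneg_right (by positivity))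
    · linarith [(h.mem_Icc (y + 1) 0 le_rfl).2, far _ 0 (not_lt.1 hc) le_rfl]
  · intro t ht
    have := far (((0 : ℕ) : ℝ) / N - r) t (by
      simp only [Nat.cast_zero, zero_div, zero_sub, abs_neg]
      exact hδr.trans (le_abs_self r)) ht.1
    linarith [(h.mem_Icc 0 t ht.1).2]
  · intro t ht
    have := far (((N + 1 : ℕ) : ℝ) / N - r) t (by
      have : 1 ≤ ((N + 1 : ℕ) : ℝ) / N := by
        rw [le_div_iff₀ hN']; push_cast; linarith
      exact le_trans (by linarith) (le_abs_self _)) ht.1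
    linarith [(h.mem_Icc (N + 1) t ht.1).2]

/-- Lower barrier. -/
theorem le_of_ge_near (h : DensitySystem N M R) {a δ r : ℝ} (ha : a ≤ 1) (hN : 0 < N)
    (hδ : 0 < δ) (hδr : δ ≤ r) (hδr' : δ ≤ 1 - r)
    (hinit : ∀ x < N, |((x : ℝ) + 1) / N - r| < δ → a ≤ R (x + 1) 0)
    {x : ℕ} (hx : x ≤ N + 1) {s : ℝ} (hs : 0 ≤ s) :
    a - (((x : ℝ) / N - r) ^ 2 + s / N ^ 2) / δ ^ 2 ≤ R x s := by
  have hc : DensitySystem N M (fun x t => 1 - R x t) :=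
    { interior := fun x hx t => by
        refine ((h.interior x hx t).const_sub 1).congr_deriv ?_
        ring
      left := fun t => ((h.left t).const_sub 1).congr_deriv (by ring)
      right := fun t => ((h.right t).const_sub 1).congr_deriv (by ring)
      mem_Icc := fun x t ht => by
        obtain ⟨h1, h2⟩ := h.mem_Icc x t ht
        constructor <;> linarith }
  have := hc.le_of_le_near (a := 1 - a) (by linarith) hN hδ hδr hδr'
    (fun y hy hyr => by linarith [hinit y hy hyr]) hx hs
  linarith

end DensitySystem

/-! ### The discrete sine series -/

/-- The discrete sine coefficients of the values `d 1, …, d N`; the mode is `k + 1`. -/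
noncomputable def sineCoeff (N : ℕ) (d : ℕ → ℝ) (k : ℕ) : ℝ :=
  2 / (N + 1) * ∑ y ∈ Finset.range N,
    d (y + 1) * Real.sin ((k + 1) * Real.pi * ((y + 1 : ℕ) / (N + 1)))

/-- One mode of the solution of the discrete heat equation with initial values `d` and with
zero boundary values at `0` and `N + 1`. -/
noncomputable def sineMode (N : ℕ) (d : ℕ → ℝ) (k x : ℕ) (t : ℝ) : ℝ :=
  sineCoeff N d k * Real.exp (-((1 - Real.cos ((k + 1) * Real.pi / (N + 1))) * t)) *
    Real.sin ((k + 1) * Real.pi * (x / (N + 1)))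

theorem sum_cos_mul_pi_div {L : ℕ} {m : ℝ} (c : ℝ) (hc : Real.cos (Real.pi * m) = c)
    (hs : Real.sin (Real.pi * m) = 0)
    (hm : Real.sin (m * Real.pi / (L + 1) / 2) ≠ 0) :
    ∑ k ∈ Finset.range L, Real.cos ((k + 1) * (m * Real.pi / (L + 1))) = (-c - 1) / 2 := by
  set θ := m * Real.pi / (L + 1) with hθ
  have tel : ∀ n : ℕ, 2 * Real.sin (θ / 2) * ∑ k ∈ Finset.range n, Real.cos ((k + 1) * θ)
      = Real.sin (n * θ + θ / 2) - Real.sin (θ / 2) := by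
    intro n
    induction n with
    | zero => simp
    | succ n ih =>
      rw [Finset.sum_range_succ, mul_add, ih]
      have h1 : ((n + 1 : ℕ) : ℝ) * θ + θ / 2 = (n + 1) * θ + θ / 2 := by push_cast; ring
      have h2 : (n : ℝ) * θ + θ / 2 = (n + 1) * θ - θ / 2 := by ring
      rw [h1, h2, Real.sin_add, Real.sin_sub]
      ring
  have h := tel L
  have hL : (L : ℝ) * θ + θ / 2 = Real.pi * m - θ / 2 := by
    rw [hθ]; field_simp; ring
  rw [hL, Real.sin_sub, hc, hs] at h
  have : Real.sin (θ / 2) * (2 * ∑ k ∈ Finset.range L, Real.cos ((k + 1) * θ) + c + 1) = 0 := by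
    linarith
  rcases mul_eq_zero.1 this with h0 | h0
  · exact absurd h0 hm
  · linarith

theorem sum_sin_mul_sin {N x y : ℕ} (hx : x < N) (hy : y < N) :
    ∑ k ∈ Finset.range N, Real.sin ((k + 1) * Real.pi * ((y + 1 : ℕ) / (N + 1))) *
      Real.sin ((k + 1) * Real.pi * ((x + 1 : ℕ) / (N + 1)))
      = if x = y then ((N : ℝ) + 1) / 2 else 0 := by
  have hN : (0 : ℝ) < N + 1 := by positivity
  have prod : ∀ k : ℕ, Real.sin ((k + 1) * Real.pi * ((y + 1 : ℕ) / (N + 1))) *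
      Real.sin ((k + 1) * Real.pi * ((x + 1 : ℕ) / (N + 1)))
      = 1 / 2 * Real.cos ((k + 1) * (((y : ℝ) - x) * Real.pi / (N + 1)))
        - 1 / 2 * Real.cos ((k + 1) * (((y : ℝ) + x + 2) * Real.pi / (N + 1))) := by
    intro k
    have h1 : ((k : ℝ) + 1) * (((y : ℝ) - x) * Real.pi / (N + 1))
        = (k + 1) * Real.pi * ((y + 1 : ℕ) / (N + 1))
          - (k + 1) * Real.pi * ((x + 1 : ℕ) / (N + 1)) := by
      push_cast; ring
    have h2 : ((k : ℝ) + 1) * (((y : ℝ) + x + 2) * Real.pi / (N + 1))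
        = (k + 1) * Real.pi * ((y + 1 : ℕ) / (N + 1))
          + (k + 1) * Real.pi * ((x + 1 : ℕ) / (N + 1)) := by
      push_cast; ring
    rw [h1, h2, Real.cos_sub, Real.cos_add]; ring
  simp only [prod, Finset.sum_sub_distrib, ← Finset.mul_sum]
  have hx' : (x : ℝ) + 1 ≤ N := by exact_mod_cast hx
  have hy' : (y : ℝ) + 1 ≤ N := by exact_mod_cast hy
  have hx0 : (0 : ℝ) ≤ x := by positivity
  have hy0 : (0 : ℝ) ≤ y := by positivity
  have cosadd : Real.cos (Real.pi * ((y : ℝ) + x + 2)) = Real.cos (Real.pi * ((y : ℝ) - x)) := by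
    have : Real.pi * ((y : ℝ) + x + 2)
        = Real.pi * ((y : ℝ) - x) + ((x + 1 : ℕ) : ℝ) * (2 * Real.pi) := by push_cast; ring
    rw [this, Real.cos_add_nat_mul_two_pi]
  have s1 : Real.sin (Real.pi * ((y : ℝ) - x)) = 0 := by
    have : Real.pi * ((y : ℝ) - x) = (((y : ℤ) - x : ℤ) : ℝ) * Real.pi := by push_cast; ring
    rw [this, Real.sin_int_mul_pi]
  have s2 : Real.sin (Real.pi * ((y : ℝ) + x + 2)) = 0 := by
    have : Real.pi * ((y : ℝ) + x + 2) = ((y + x + 2 : ℕ) : ℝ) * Real.pi := by push_cast; ring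
    rw [this, Real.sin_nat_mul_pi]
  have hpi := Real.pi_pos
  have hplus := sum_cos_mul_pi_div (L := N) _ cosadd s2 (by
    refine (Real.sin_pos_of_pos_of_lt_pi (by positivity) ?_).ne'
    rw [div_div, div_lt_iff₀ (by positivity)]
    nlinarith)
  rw [hplus]
  split_ifs with hxy
  · subst hxy
    simp
    ring
  · have hminus := sum_cos_mul_pi_div (L := N) (m := (y : ℝ) - x) _ rfl s1 (by
      have habs : |((y : ℝ) - x) * Real.pi / (N + 1) / 2| < Real.pi := by
        rw [div_div, abs_div, abs_mul, abs_of_pos hpi,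
          abs_of_pos (show (0 : ℝ) < (N + 1) * 2 by positivity), div_lt_iff₀ (by positivity)]
        have : |(y : ℝ) - x| < (N + 1) * 2 := by rw [abs_lt]; constructor <;> linarith
        nlinarith
      rw [Ne, Real.sin_eq_zero_iff_of_lt_of_lt (abs_lt.1 habs).1 (abs_lt.1 habs).2]
      have : (y : ℝ) - x ≠ 0 := sub_ne_zero.2 (by exact_mod_cast Ne.symm hxy)
      positivity)
    rw [hminus]; ring

/-- The discrete sine series reproduces its initial values. -/
theorem sum_sineMode_zero {N : ℕ} (d : ℕ → ℝ) {x : ℕ} (hx : x < N) :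
    ∑ k ∈ Finset.range N, sineMode N d k (x + 1) 0 = d (x + 1) := by
  have hN : (N : ℝ) + 1 ≠ 0 := by positivity
  simp only [sineMode, sineCoeff, mul_zero, neg_zero, Real.exp_zero, mul_one]
  simp_rw [mul_assoc (2 / ((N : ℝ) + 1)), Finset.sum_mul]
  rw [← Finset.mul_sum, Finset.sum_comm]
  have : ∀ y ∈ Finset.range N, ∑ k ∈ Finset.range N,
      d (y + 1) * Real.sin ((k + 1) * Real.pi * ((y + 1 : ℕ) / (N + 1))) *
        Real.sin ((k + 1) * Real.pi * ((x + 1 : ℕ) / (N + 1)))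
      = if x = y then d (y + 1) * (((N : ℝ) + 1) / 2) else 0 := by
    intro y hy
    simp only [mul_assoc (d (y + 1)), ← Finset.mul_sum]
    rw [sum_sin_mul_sin hx (Finset.mem_range.1 hy)]
    split_ifs <;> simp
  rw [Finset.sum_congr rfl this, Finset.sum_ite_eq, if_pos (Finset.mem_range.2 hx)]
  field_simp

theorem hasDerivAt_sineMode (N : ℕ) (d : ℕ → ℝ) (k x : ℕ) (t : ℝ) :
    HasDerivAt (sineMode N d k (x + 1))
      (1 / 2 * (sineMode N d k (x + 2) t + sineMode N d k x t
        - 2 * sineMode N d k (x + 1) t)) t := by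
  have h := (((((hasDerivAt_id t).const_mul
    (1 - Real.cos ((k + 1) * Real.pi / (N + 1)))).fun_neg.exp).const_mul (sineCoeff N d k)).mul_const
    (Real.sin ((k + 1) * Real.pi * ((x + 1 : ℕ) / (N + 1)))))
  refine h.congr_deriv ?_
  have h1 : ((k : ℝ) + 1) * Real.pi * ((x + 2 : ℕ) / (N + 1))
      = (k + 1) * Real.pi * ((x + 1 : ℕ) / (N + 1)) + (k + 1) * Real.pi / (N + 1) := by
    push_cast; ring
  have h2 : ((k : ℝ) + 1) * Real.pi * ((x : ℝ) / (N + 1))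
      = (k + 1) * Real.pi * ((x + 1 : ℕ) / (N + 1)) - (k + 1) * Real.pi / (N + 1) := by
    push_cast; ring
  simp only [sineMode]
  rw [h1, h2, Real.sin_add, Real.sin_sub]
  simp only [id]
  ring

theorem sineMode_left (N : ℕ) (d : ℕ → ℝ) (k : ℕ) (t : ℝ) : sineMode N d k 0 t = 0 := by
  simp [sineMode]

theorem sineMode_right (N : ℕ) (d : ℕ → ℝ) (k : ℕ) (t : ℝ) : sineMode N d k (N + 1) t = 0 := by
  have hN : (N : ℝ) + 1 ≠ 0 := by positivity
  have : ((k : ℝ) + 1) * Real.pi * (((N + 1 : ℕ) : ℝ) / (N + 1)) = ((k + 1 : ℕ) : ℝ) * Real.pi := by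
    push_cast; field_simp
  rw [sineMode, this, Real.sin_nat_mul_pi, mul_zero]

theorem abs_sineCoeff_le {N : ℕ} {d : ℕ → ℝ} (hd : ∀ y < N, |d (y + 1)| ≤ 1) (k : ℕ) :
    |sineCoeff N d k| ≤ 2 := by
  have hN : (0 : ℝ) < N + 1 := by positivity
  rw [sineCoeff, abs_mul, abs_of_pos (by positivity : (0 : ℝ) < 2 / (N + 1))]
  have : |∑ y ∈ Finset.range N,
      d (y + 1) * Real.sin ((k + 1) * Real.pi * ((y + 1 : ℕ) / (N + 1)))| ≤ N + 1 := by
    refine (Finset.abs_sum_le_sum_abs _ _).trans ?_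
    refine (Finset.sum_le_sum (g := fun _ => (1 : ℝ)) fun y hy => ?_).trans (by simp)
    rw [abs_mul]
    exact mul_le_one₀ (hd y (Finset.mem_range.1 hy)) (abs_nonneg _) (Real.abs_sin_le_one _)
  calc 2 / ((N : ℝ) + 1) * _ ≤ 2 / ((N : ℝ) + 1) * (N + 1) := by gcongr
    _ = 2 := by field_simp

theorem abs_sineMode_le {N : ℕ} {d : ℕ → ℝ} (hd : ∀ y < N, |d (y + 1)| ≤ 1) {k : ℕ} (hk : k < N)
    (x : ℕ) {q s : ℝ} (hs : 0 ≤ s) (hq : q * (N + 1) ^ 2 ≤ 2 * s) :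
    |sineMode N d k x s| ≤ 2 * Real.exp (-((k + 1) * q)) := by
  have hN : (0 : ℝ) < N + 1 := by positivity
  have hk' : (k : ℝ) + 1 ≤ N := by exact_mod_cast hk
  have hpi := Real.pi_pos
  rw [sineMode, abs_mul, abs_mul, Real.abs_exp]
  have hexp : ((k : ℝ) + 1) * q ≤ (1 - Real.cos ((k + 1) * Real.pi / (N + 1))) * s := by
    have hcos := Real.cos_le_one_sub_mul_cos_sq (x := (k + 1) * Real.pi / (N + 1)) (by
      rw [abs_of_nonneg (by positivity), div_le_iff₀ hN]
      nlinarith)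
    have h1 : 2 / Real.pi ^ 2 * ((k + 1) * Real.pi / (N + 1)) ^ 2
        = 2 * ((k : ℝ) + 1) ^ 2 / (N + 1) ^ 2 := by field_simp
    rw [h1] at hcos
    calc ((k : ℝ) + 1) * q ≤ (k + 1) * (2 * s / (N + 1) ^ 2) := by
          gcongr; rw [le_div_iff₀ (by positivity)]; exact hq
      _ ≤ ((k : ℝ) + 1) ^ 2 * (2 * s / (N + 1) ^ 2) := by
          gcongr
          have : (0 : ℝ) ≤ k := by positivity
          nlinarith
      _ = 2 * ((k : ℝ) + 1) ^ 2 / (N + 1) ^ 2 * s := by ring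
      _ ≤ _ := by gcongr; linarith
  calc _ ≤ 2 * Real.exp (-((k + 1) * q)) * 1 := by
        gcongr
        · exact abs_sineCoeff_le hd k
        · exact Real.abs_sin_le_one _
    _ = _ := mul_one _

/-- The density is close to the stationary profile plus the discrete sine series, as long as the
reservoirs stay close to their limits `a`, `b`. -/
theorem DensitySystem.abs_sub_sineSeries_le {N : ℕ} {M : ℝ} {R : ℕ → ℝ → ℝ}
    (h : DensitySystem N M R) {a b e T : ℝ}
    (hleft : ∀ t ∈ Set.Icc 0 T, |R 0 t - a| ≤ e)
    (hright : ∀ t ∈ Set.Icc 0 T, |R (N + 1) t - b| ≤ e)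
    {x : ℕ} (hx : x ≤ N + 1) {t : ℝ} (ht : t ∈ Set.Icc 0 T) :
    |R x t - ((b - a) * (x / (N + 1)) + a
      + ∑ k ∈ Finset.range N,
        sineMode N (fun y => R y 0 - ((b - a) * (y / (N + 1)) + a)) k x t)| ≤ e := by
  set d : ℕ → ℝ := fun y => R y 0 - ((b - a) * (y / (N + 1)) + a) with hd
  set V : ℕ → ℝ → ℝ := fun x t => R x t - ((b - a) * (x / (N + 1)) + a
    + ∑ k ∈ Finset.range N, sineMode N d k x t) with hV
  have hN : (N : ℝ) + 1 ≠ 0 := by positivity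
  have he : 0 ≤ e := (abs_nonneg _).trans (hleft t ht)
  have hder : ∀ x < N, ∀ t,
      HasDerivAt (V (x + 1)) (1 / 2 * (V (x + 2) t + V x t - 2 * V (x + 1) t)) t := by
    intro x hx t
    have h1 := HasDerivAt.fun_sum (u := Finset.range N) fun k _ => hasDerivAt_sineMode N d k x t
    refine ((h.interior x hx t).fun_sub
      (h1.const_add ((b - a) * ((x + 1 : ℕ) / (N + 1)) + a))).congr_deriv ?_
    simp only [hV, ← Finset.mul_sum, Finset.sum_add_distrib, Finset.sum_sub_distrib]
    push_cast
    ring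
  have h0 : ∀ x < N, V (x + 1) 0 = 0 := by
    intro x hx
    simp only [hV, sum_sineMode_zero d hx]
    simp [hd]
  have hl : ∀ t, V 0 t = R 0 t - a := fun t => by simp [hV, sineMode_left]
  have hr : ∀ t, V (N + 1) t = R (N + 1) t - b := fun t => by
    simp [hV, sineMode_right, hN]
  have up := discrete_heat_nonpos (N := N) (T := T) (g := fun x t => V x t - e)
    (fun x hx t => ((hder x hx t).sub_const e).congr_deriv (by ring))
    (fun x hx => by simp only [h0 x hx]; linarith)
    (fun t ht => by simp only [hl]; linarith [(abs_le.1 (hleft t ht)).2])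
    (fun t ht => by simp only [hr]; linarith [(abs_le.1 (hright t ht)).2]) x hx t ht
  have lo := discrete_heat_nonpos (N := N) (T := T) (g := fun x t => -V x t - e)
    (fun x hx t => ((hder x hx t).fun_neg.sub_const e).congr_deriv (by ring))
    (fun x hx => by simp only [h0 x hx]; linarith)
    (fun t ht => by simp only [hl]; linarith [(abs_le.1 (hleft t ht)).1])
    (fun t ht => by simp only [hr]; linarith [(abs_le.1 (hright t ht)).1]) x hx t ht
  rw [abs_le]
  constructor <;> simp only [hV] at up lo ⊢ <;> linarith

/-! ### Action of the generator on the occupation variables -/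

section Generator

variable {N M : ℕ}

theorem eta_zero (w : State N M) : eta w 0 = (w.2.1 : ℝ) / M := by simp [eta]

theorem eta_succ (w : State N M) {x : ℕ} (hx : x < N) : eta w (x + 1) = occ (w.1 ⟨x, hx⟩) := by
  simp [eta, hx]

theorem eta_right (w : State N M) : eta w (N + 1) = (w.2.2 : ℝ) / M := by simp [eta]

theorem eta_mem_Icc (hM : 0 < M) (w : State N M) (x : ℕ) : eta w x ∈ Set.Icc (0 : ℝ) 1 := by
  have hfin : ∀ n : Fin (M + 1), (n : ℝ) / M ∈ Set.Icc (0 : ℝ) 1 := fun n =>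
    ⟨by positivity, by
      rw [div_le_one (by exact_mod_cast hM)]
      exact_mod_cast Nat.lt_succ_iff.1 n.2⟩
  unfold eta
  split_ifs
  · exact hfin _
  · unfold occ; split_ifs <;> simp
  · exact hfin _

theorem boundaryRate_mul_reservoir (hM : 0 < M) (n : Fin (M + 1)) (b : Bool) :
    boundaryRate n b * ((reservoirUpdate n b : ℝ) / M - (n : ℝ) / M)
      = (occ b - (n : ℝ) / M) / (2 * M) := by
  have hM' : (M : ℝ) ≠ 0 := by exact_mod_cast hM.ne'
  cases b
  · rcases Nat.eq_zero_or_pos (n : ℕ) with h | h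
    · simp [boundaryRate, reservoirUpdate, occ, h]
    · simp only [boundaryRate, reservoirUpdate, occ, Bool.false_eq_true, if_false]
      rw [Nat.cast_sub h]
      field_simp
      push_cast
      ring
  · rcases (Nat.lt_succ_iff.1 n.2).eq_or_lt with h | h
    · simp [boundaryRate, reservoirUpdate, occ, h, hM']
    · simp only [boundaryRate, reservoirUpdate, occ, if_true]
      rw [min_eq_left (Nat.succ_le_of_lt h)]
      field_simp
      push_cast
      ring

theorem boundaryRate_mul_site (n : Fin (M + 1)) (b : Bool) :
    boundaryRate n b * (occ (!b) - occ b) = 1 / 2 * ((n : ℝ) / M - occ b) := by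
  cases b <;> simp [boundaryRate, occ]
  ring

theorem generator_apply (f : State N M → ℝ) (w : State N M) :
    generator N M f w =
    1 / 2 * (∑ i : Fin N, ∑ j : Fin N,
        if (i : ℕ) + 1 = j then f (exchange i j w) - f w else 0)
      + (∑ i : Fin N, if (i : ℕ) + 1 = N then
          boundaryRate w.2.2 (w.1 i) * (f (flipRight i w) - f w) else 0)
      + (∑ i : Fin N, if (i : ℕ) = 0 then
          boundaryRate w.2.1 (w.1 i) * (f (flipLeft i w) - f w) else 0) := rfl

theorem sum_ite_val_eq {n : ℕ} (k : Fin n) (p : Fin n → Prop) [DecidablePred p] (hp : p k)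
    (hk : ∀ i, p i → i = k) (F : Fin n → ℝ) : (∑ i : Fin n, if p i then F i else 0) = F k := by
  rw [Finset.sum_eq_single k]
  · rw [if_pos hp]
  · intro i _ hi
    rw [if_neg fun h => hi (hk i h)]
  · simp

theorem generator_eta_zero (hN : 0 < N) (hM : 0 < M) (w : State N M) :
    generator N M (fun w => eta w 0) w = (eta w 1 - eta w 0) / (2 * M) := by
  rw [generator_apply, sum_ite_val_eq (n := N) ⟨0, hN⟩ (fun i => (i : ℕ) = 0) rfl
    (fun i hi => Fin.ext hi)]
  simp only [eta_zero, exchange, flipRight, flipLeft, sub_self, ite_self, Finset.sum_const_zero,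
    mul_zero, zero_add]
  rw [boundaryRate_mul_reservoir hM, ← eta_succ w hN]

theorem generator_eta_right (hN : 0 < N) (hM : 0 < M) (w : State N M) :
    generator N M (fun w => eta w (N + 1)) w = (eta w N - eta w (N + 1)) / (2 * M) := by
  obtain ⟨n, rfl⟩ : ∃ n, N = n + 1 := ⟨N - 1, by omega⟩
  rw [generator_apply, sum_ite_val_eq (n := n + 1) ⟨n, by omega⟩ (fun i => (i : ℕ) + 1 = n + 1) rfl
    (fun i hi => Fin.ext (by simpa using hi))]
  simp only [eta_right, exchange, flipRight, flipLeft, sub_self, ite_self, Finset.sum_const_zero,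
    mul_zero, zero_add, add_zero]
  rw [boundaryRate_mul_reservoir hM, eta_succ w (Nat.lt_succ_self n)]

theorem occ_swap_sub (η : Fin N → Bool) (i j k : Fin N) (hij : (i : ℕ) + 1 = j) :
    occ (η (Equiv.swap i j k)) - occ (η k)
      = (if i = k then occ (η j) - occ (η k) else 0)
        + (if j = k then occ (η i) - occ (η k) else 0) := by
  have hne : i ≠ j := fun h => by rw [h] at hij; omega
  by_cases h1 : i = k
  · subst h1
    simp [hne.symm]
  · by_cases h2 : j = k
    · subst h2
      simp [h1]
    · rw [Equiv.swap_apply_of_ne_of_ne (Ne.symm h1) (Ne.symm h2)]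
      simp [h1, h2]

theorem sum_exchange (η : Fin N → Bool) (k : Fin N) :
    (∑ i : Fin N, ∑ j : Fin N,
        if (i : ℕ) + 1 = j then occ (η (Equiv.swap i j k)) - occ (η k) else 0)
      = (if h : (k : ℕ) + 1 < N then occ (η ⟨k + 1, h⟩) - occ (η k) else 0)
        + (if h : 0 < (k : ℕ) then occ (η ⟨k - 1, by omega⟩) - occ (η k) else 0) := by
  have split : ∀ i j : Fin N,
      (if (i : ℕ) + 1 = j then occ (η (Equiv.swap i j k)) - occ (η k) else 0)
      = (if i = k then (if (i : ℕ) + 1 = j then occ (η j) - occ (η k) else 0) else 0)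
        + (if j = k then (if (i : ℕ) + 1 = j then occ (η i) - occ (η k) else 0) else 0) := by
    intro i j
    by_cases h : (i : ℕ) + 1 = j
    · simp only [if_pos h, occ_swap_sub η i j k h]
    · simp [h]
  simp only [split, Finset.sum_add_distrib]
  congr 1
  · rw [Finset.sum_comm]
    simp only [Finset.sum_ite_eq', Finset.mem_univ, if_true]
    split_ifs with h
    · exact sum_ite_val_eq (⟨k + 1, h⟩ : Fin N) (fun j => (k : ℕ) + 1 = j) rfl
        (fun j hj => Fin.ext hj.symm) (fun j => occ (η j) - occ (η k))
    · exact Finset.sum_eq_zero fun j _ => if_neg fun hj => h (by omega)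
  · simp only [Finset.sum_ite_eq', Finset.mem_univ, if_true]
    split_ifs with h
    · exact sum_ite_val_eq (⟨k - 1, by omega⟩ : Fin N) (fun i => (i : ℕ) + 1 = k)
        (by simp; omega) (fun i hi => Fin.ext (by simp; omega)) (fun i => occ (η i) - occ (η k))
    · exact Finset.sum_eq_zero fun j _ => if_neg fun hj => h (by omega)

theorem generator_eta_succ {x : ℕ} (hx : x < N) (w : State N M) :
    generator N M (fun w => eta w (x + 1)) w
      = 1 / 2 * (eta w (x + 2) + eta w x - 2 * eta w (x + 1)) := by
  rw [generator_apply]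
  simp only [eta_succ _ hx]
  have hex : (∑ i : Fin N, ∑ j : Fin N, if (i : ℕ) + 1 = j then
      occ ((exchange i j w).1 ⟨x, hx⟩) - occ (w.1 ⟨x, hx⟩) else 0)
      = (if h : x + 1 < N then occ (w.1 ⟨x + 1, h⟩) - occ (w.1 ⟨x, hx⟩) else 0)
        + (if h : 0 < x then occ (w.1 ⟨x - 1, by omega⟩) - occ (w.1 ⟨x, hx⟩) else 0) :=
    sum_exchange w.1 ⟨x, hx⟩
  have hupd : ∀ i : Fin N, i ≠ ⟨x, hx⟩ → ∀ b,
      occ (Function.update w.1 i b ⟨x, hx⟩) - occ (w.1 ⟨x, hx⟩) = 0 := fun i hi b => by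
    rw [Function.update_of_ne (Ne.symm hi), sub_self]
  have hright : (∑ i : Fin N, if (i : ℕ) + 1 = N then boundaryRate w.2.2 (w.1 i) *
      (occ ((flipRight i w).1 ⟨x, hx⟩) - occ (w.1 ⟨x, hx⟩)) else 0)
      = if x + 1 = N then 1 / 2 * ((w.2.2 : ℝ) / M - occ (w.1 ⟨x, hx⟩)) else 0 := by
    rw [Finset.sum_eq_single ⟨x, hx⟩]
    · simp only [flipRight, Function.update_self, boundaryRate_mul_site]
    · intro i _ hi
      simp only [flipRight, hupd i hi, mul_zero, ite_self]
    · simp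
  have hleft : (∑ i : Fin N, if (i : ℕ) = 0 then boundaryRate w.2.1 (w.1 i) *
      (occ ((flipLeft i w).1 ⟨x, hx⟩) - occ (w.1 ⟨x, hx⟩)) else 0)
      = if x = 0 then 1 / 2 * ((w.2.1 : ℝ) / M - occ (w.1 ⟨x, hx⟩)) else 0 := by
    rw [Finset.sum_eq_single ⟨x, hx⟩]
    · simp only [flipLeft, Function.update_self, boundaryRate_mul_site]
    · intro i _ hi
      simp only [flipLeft, hupd i hi, mul_zero, ite_self]
    · simp
  rw [hex, hright, hleft]
  have hup : (if h : x + 1 < N then occ (w.1 ⟨x + 1, h⟩) - occ (w.1 ⟨x, hx⟩) else 0)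
      + 2 * (if x + 1 = N then 1 / 2 * ((w.2.2 : ℝ) / M - occ (w.1 ⟨x, hx⟩)) else 0)
      = eta w (x + 2) - occ (w.1 ⟨x, hx⟩) := by
    by_cases h : x + 1 < N
    · rw [dif_pos h, if_neg h.ne, eta_succ w h]; ring
    · obtain rfl : N = x + 1 := by omega
      rw [dif_neg h, if_pos rfl, eta_right w]; ring
  have hdown : (if h : 0 < x then occ (w.1 ⟨x - 1, by omega⟩) - occ (w.1 ⟨x, hx⟩) else 0)
      + 2 * (if x = 0 then 1 / 2 * ((w.2.1 : ℝ) / M - occ (w.1 ⟨x, hx⟩)) else 0)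
      = eta w x - occ (w.1 ⟨x, hx⟩) := by
    rcases x with _ | x
    · simp [eta_zero]
    · have hx' : x < N := by omega
      simp [eta_succ w hx']
  linarith

end Generator

/-! ### Expectations under a Markov process -/

section Markov

variable {S : Type*} [Fintype S] [MeasurableSpace S]
  {Ω : Type*} [MeasurableSpace Ω] {P : Measure Ω} [IsProbabilityMeasure P]

theorem IsMarkovProcess.integral_eq {L : (S → ℝ) →ₗ[ℝ] (S → ℝ)} {X : ℝ≥0 → Ω → S}
    (hX : IsMarkovProcess L P X) (t : ℝ≥0) (f : S → ℝ) :
    ∫ ω, f (X t ω) ∂P = ∫ ω, semigroup L t f (X 0 ω) ∂P := by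
  have hle : (⨆ u : Set.Iic (0 : ℝ≥0), MeasurableSpace.comap (X u) inferInstance)
      ≤ (inferInstance : MeasurableSpace Ω) :=
    iSup_le fun u => (hX.measurable u).comap_le
  have h := hX.markov 0 t f
  rw [zero_add] at h
  rw [← integral_condExp hle]
  exact integral_congr_ae h

variable [MeasurableSingletonClass S]

theorem integrable_comp_of_finite {Y : Ω → S} (hY : Measurable Y) (f : S → ℝ) :
    Integrable (fun ω => f (Y ω)) P := by
  obtain ⟨C, hC⟩ := (Set.finite_range fun s => ‖f s‖).bddAbove
  exact Integrable.of_bound ((measurable_of_finite f).comp hY).aestronglyMeasurable C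
    (Eventually.of_forall fun ω => hC ⟨Y ω, rfl⟩)

/-- Expectation at a fixed time as a linear functional on functions of the state. -/
noncomputable def expectation (P : Measure Ω) [IsProbabilityMeasure P] {Y : Ω → S}
    (hY : Measurable Y) : (S → ℝ) →L[ℝ] ℝ :=
  LinearMap.toContinuousLinearMap
    { toFun := fun f => ∫ ω, f (Y ω) ∂P
      map_add' := fun f g =>
        integral_add (integrable_comp_of_finite hY f) (integrable_comp_of_finite hY g)
      map_smul' := fun c _ => integral_const_mul c _ }

theorem hasDerivAt_expectation_semigroup (L : (S → ℝ) →ₗ[ℝ] (S → ℝ)) {Y : Ω → S}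
    (hY : Measurable Y) (f : S → ℝ) (t : ℝ) :
    HasDerivAt
      (fun t : ℝ => expectation P hY (NormedSpace.exp (t • LinearMap.toContinuousLinearMap L) f))
      (expectation P hY (NormedSpace.exp (t • LinearMap.toContinuousLinearMap L) (L f))) t := by
  have h := hasDerivAt_exp_smul_const (𝕂 := ℝ) (LinearMap.toContinuousLinearMap L) t
  have h2 := (expectation P hY).hasFDerivAt.comp_hasDerivAt t
    (h.clm_apply (hasDerivAt_const t f))
  refine HasDerivAt.congr_deriv (f := fun t : ℝ => expectation P hY
    (NormedSpace.exp (t • LinearMap.toContinuousLinearMap L) f)) h2 ?_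
  simp

end Markov

/-! ### The densities of the particle system -/

section Density

variable {N M : ℕ} {Ω : Type*} [MeasurableSpace Ω] {P : Measure Ω} [IsProbabilityMeasure P]

theorem abs_integral_sub_le {Y : Ω → ℝ} (hY : Measurable Y) (hmem : ∀ ω, Y ω ∈ Set.Icc (0 : ℝ) 1)
    {v δ : ℝ} (hv : v ∈ Set.Icc (0 : ℝ) 1) (hδ : 0 ≤ δ) :
    |∫ ω, Y ω ∂P - v| ≤ δ + P.real {ω | δ ≤ |Y ω - v|} := by
  have hset : MeasurableSet {ω | δ ≤ |Y ω - v|} :=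
    measurableSet_le measurable_const ((hY.sub_const v).abs)
  have hint : Integrable Y P := Integrable.of_bound hY.aestronglyMeasurable 1
    (Eventually.of_forall fun ω => by
      rw [Real.norm_eq_abs, abs_le]; constructor <;> linarith [(hmem ω).1, (hmem ω).2])
  have hind : Integrable ({ω | δ ≤ |Y ω - v|}.indicator fun _ => (1 : ℝ)) P :=
    (integrable_const 1).indicator hset
  have h1 : ∫ ω, Y ω ∂P - v = ∫ ω, (Y ω - v) ∂P := by
    rw [integral_sub hint (integrable_const v)]; simp
  have h2 : δ + P.real {ω | δ ≤ |Y ω - v|}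
      = ∫ ω, (δ + {ω | δ ≤ |Y ω - v|}.indicator (fun _ => (1 : ℝ)) ω) ∂P := by
    rw [integral_add (integrable_const δ) hind, integral_indicator_const _ hset]; simp
  rw [h1, h2]
  refine abs_integral_le_integral_abs.trans (integral_mono (hint.sub (integrable_const v)).abs
    ((integrable_const δ).add hind) fun ω => ?_)
  by_cases h : δ ≤ |Y ω - v|
  · have : |Y ω - v| ≤ 1 := by
      rw [abs_le]; constructor <;> linarith [(hmem ω).1, (hmem ω).2, hv.1, hv.2]
    simp only [Set.indicator, Set.mem_ofPred_eq, h, if_true]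
    linarith
  · simp only [Set.indicator, Set.mem_ofPred_eq, h, if_false]
    linarith [not_le.1 h]

/-- Convergence in probability of `[0, 1]`-valued variables implies that of the expectations. -/
theorem tendsto_of_tendsto_in_probability {Ω : ℕ → Type*} [∀ N, MeasurableSpace (Ω N)] {v : ℝ}
    (hv : v ∈ Set.Icc (0 : ℝ) 1) (P : ∀ N, Measure (Ω N)) [∀ N, IsProbabilityMeasure (P N)]
    (Y : ∀ N, Ω N → ℝ)
    (hY : ∀ᶠ N in atTop, Measurable (Y N) ∧ ∀ ω, Y N ω ∈ Set.Icc (0 : ℝ) 1)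
    (hprob : ∀ δ > 0, Tendsto (fun N => P N {ω | δ ≤ |Y N ω - v|}) atTop (𝓝 0)) {E : ℕ → ℝ}
    (hE : ∀ᶠ N in atTop, ∫ ω, Y N ω ∂(P N) = E N) : Tendsto E atTop (𝓝 v) := by
  rw [Metric.tendsto_nhds]
  intro e he
  have h1 : Tendsto (fun N => (P N).real {ω | e / 2 ≤ |Y N ω - v|}) atTop (𝓝 0) := by
    simpa [Measure.real, Function.comp_def] using (ENNReal.tendsto_toReal ENNReal.zero_ne_top).comp
      (hprob (e / 2) (half_pos he))
  filter_upwards [hY, hE, h1.eventually_lt_const (half_pos he)] with N hN hEN hlt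
  rw [Real.dist_eq, ← hEN]
  linarith [abs_integral_sub_le (P := P N) hN.1 hN.2 hv (half_pos he).le]

theorem measurable_eta_comp {Y : Ω → State N M} (hY : Measurable Y) (x : ℕ) :
    Measurable fun ω => eta (Y ω) x :=
  (measurable_of_finite fun w : State N M => eta w x).comp hY

theorem rho_mem_Icc (hM : 0 < M) {X : ℝ≥0 → Ω → State N M} {t : ℝ≥0} (hX : Measurable (X t))
    (x : ℕ) : rho P X x t ∈ Set.Icc (0 : ℝ) 1 := by
  refine ⟨integral_nonneg fun ω => (eta_mem_Icc hM _ x).1, ?_⟩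
  calc rho P X x t ≤ ∫ _, (1 : ℝ) ∂P :=
        integral_mono (integrable_comp_of_finite hX fun w => eta w x) (integrable_const 1)
          fun ω => (eta_mem_Icc hM _ x).2
    _ = 1 := by simp

/-- The densities of the particle system solve the closed system of equations. -/
theorem IsMarkovProcess.exists_densitySystem (hN : 0 < N) (hM : 0 < M)
    {X : ℝ≥0 → Ω → State N M} (hX : IsMarkovProcess (generator N M) P X) :
    ∃ R : ℕ → ℝ → ℝ, DensitySystem N M R ∧ ∀ x (t : ℝ≥0), R x t = rho P X x t := by
  set R : ℕ → ℝ → ℝ := fun x t => expectation P (hX.measurable 0)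
    (NormedSpace.exp (t • LinearMap.toContinuousLinearMap (generator N M)) fun w => eta w x)
    with hR
  have hRrho : ∀ x (t : ℝ≥0), R x t = rho P X x t := fun x t =>
    (hX.integral_eq t fun w => eta w x).symm
  have hder : ∀ x t, HasDerivAt (R x) (expectation P (hX.measurable 0)
      (NormedSpace.exp (t • LinearMap.toContinuousLinearMap (generator N M))
        (generator N M fun w => eta w x))) t :=
    fun x t => hasDerivAt_expectation_semigroup _ (hX.measurable 0) _ t
  refine ⟨R, ⟨fun x hx t => ?_, fun t => ?_, fun t => ?_, fun x t ht => ?_⟩, hRrho⟩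
  · refine (hder (x + 1) t).congr_deriv ?_
    have : (generator N M fun w => eta w (x + 1))
        = (1 / 2 : ℝ) • ((fun w => eta w (x + 2)) + (fun w => eta w x)
          - (2 : ℝ) • fun w => eta w (x + 1)) := by
      funext w
      simpa using generator_eta_succ hx w
    rw [this]
    simp only [map_smul, map_add, map_sub, hR, smul_eq_mul]
  · refine (hder 0 t).congr_deriv ?_
    have : (generator N M fun w => eta w 0)
        = (1 / (2 * M) : ℝ) • ((fun w => eta w 1) - fun w => eta w 0) := by
      funext w
      rw [generator_eta_zero hN hM]
      simp only [Pi.smul_apply, Pi.sub_apply, smul_eq_mul]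
      ring
    rw [this]
    simp only [map_smul, map_sub, hR, smul_eq_mul]
    ring
  · refine (hder (N + 1) t).congr_deriv ?_
    have : (generator N M fun w => eta w (N + 1))
        = (1 / (2 * M) : ℝ) • ((fun w => eta w N) - fun w => eta w (N + 1)) := by
      funext w
      rw [generator_eta_right hN hM]
      simp only [Pi.smul_apply, Pi.sub_apply, smul_eq_mul]
      ring
    rw [this]
    simp only [map_smul, map_sub, hR, smul_eq_mul]
    ring
  · lift t to ℝ≥0 using ht
    rw [hRrho]
    exact rho_mem_Icc hM (hX.measurable t) x

end Density

/-! ### Trigonometric series solutions of the heat equation -/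

/-- `∑ c k exp (-(k+1)² π² t / 2) φ ((k+1) π r)`. -/
noncomputable def heatSeries (c : ℕ → ℝ) (φ : ℝ → ℝ) (r t : ℝ) : ℝ :=
  ∑' k : ℕ, c k * Real.exp (-(((k + 1) * Real.pi) ^ 2 / 2 * t)) * φ ((k + 1) * Real.pi * r)

/-- Polynomial growth of a sequence of coefficients. -/
def PolyBounded (c : ℕ → ℝ) : Prop := ∃ (C : ℝ) (m : ℕ), ∀ k : ℕ, |c k| ≤ C * ((k : ℝ) + 1) ^ m

theorem PolyBounded.mul_freq {c : ℕ → ℝ} (h : PolyBounded c) :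
    PolyBounded fun k => c k * ((k + 1) * Real.pi) := by
  obtain ⟨C, m, h⟩ := h
  refine ⟨C * Real.pi, m + 1, fun k => ?_⟩
  have hk : (0 : ℝ) ≤ (k + 1) * Real.pi := by have := Real.pi_pos; positivity
  rw [abs_mul, abs_of_nonneg hk]
  calc |c k| * ((k + 1) * Real.pi) ≤ C * ((k : ℝ) + 1) ^ m * ((k + 1) * Real.pi) := by
        gcongr; exact h k
    _ = _ := by ring

theorem PolyBounded.const_mul {c : ℕ → ℝ} (h : PolyBounded c) (a : ℝ) :
    PolyBounded fun k => a * c k := by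
  obtain ⟨C, m, h⟩ := h
  refine ⟨|a| * C, m, fun k => ?_⟩
  rw [abs_mul, mul_assoc]
  gcongr
  exact h k

section HeatSeries

variable {c : ℕ → ℝ} {φ : ℝ → ℝ}

/-- Uniform summable bound for the terms of a heat series at times `t ≥ τ > 0`. -/
theorem PolyBounded.exists_summable_bound (hc : PolyBounded c) (hφ : ∀ x, |φ x| ≤ 1)
    {τ : ℝ} (hτ : 0 < τ) : ∃ U : ℕ → ℝ, Summable U ∧ ∀ k : ℕ, ∀ r : ℝ, ∀ t ≥ τ,
      ‖c k * Real.exp (-(((k + 1) * Real.pi) ^ 2 / 2 * t)) * φ ((k + 1) * Real.pi * r)‖ ≤ U k := by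
  obtain ⟨C, m, hC⟩ := hc
  refine ⟨fun k => C * (((k + 1 : ℕ) : ℝ) ^ m * Real.exp (-τ * (k + 1 : ℕ))), ?_, ?_⟩
  · exact ((summable_nat_add_iff 1).2 (Real.summable_pow_mul_exp_neg_nat_mul m hτ)).mul_left C
  · intro k r t ht
    have hexp : τ * ((k : ℝ) + 1) ≤ ((k + 1) * Real.pi) ^ 2 / 2 * t := by
      have hpi : 2 ≤ Real.pi ^ 2 := by nlinarith [Real.pi_gt_three]
      have hk : (0 : ℝ) ≤ k := by positivity
      calc τ * ((k : ℝ) + 1) ≤ t * ((k : ℝ) + 1) ^ 2 := by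
            gcongr
            · exact hτ.le.trans ht
            · nlinarith
        _ = ((k : ℝ) + 1) ^ 2 * 2 / 2 * t := by ring
        _ ≤ ((k : ℝ) + 1) ^ 2 * Real.pi ^ 2 / 2 * t := by
            have : 0 ≤ t := hτ.le.trans ht
            gcongr
        _ = _ := by ring
    rw [Real.norm_eq_abs, abs_mul, abs_mul, Real.abs_exp]
    have h0 : 0 ≤ C * ((k : ℝ) + 1) ^ m := (abs_nonneg _).trans (hC k)
    calc _ ≤ C * ((k : ℝ) + 1) ^ m * Real.exp (-(τ * (k + 1))) * 1 := by
          gcongr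
          · exact hC k
          · exact hφ _
      _ = _ := by push_cast; ring_nf

theorem summable_heatSeries (hc : PolyBounded c) (hφ : ∀ x, |φ x| ≤ 1) (r : ℝ) {t : ℝ}
    (ht : 0 < t) : Summable fun k : ℕ =>
      c k * Real.exp (-(((k + 1) * Real.pi) ^ 2 / 2 * t)) * φ ((k + 1) * Real.pi * r) := by
  obtain ⟨U, hU, h⟩ := hc.exists_summable_bound hφ ht
  exact Summable.of_norm_bounded hU fun k => h k r t le_rfl

theorem continuousOn_heatSeries (hc : PolyBounded c) (hφ : ∀ x, |φ x| ≤ 1) (hφc : Continuous φ) :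
    ContinuousOn (Function.uncurry (heatSeries c φ)) (Set.univ ×ˢ Set.Ioi 0) := by
  rintro ⟨r, t⟩ ⟨-, ht⟩
  have ht : 0 < t := ht
  obtain ⟨U, hU, h⟩ := hc.exists_summable_bound hφ (half_pos ht)
  have hopen : (Set.univ : Set ℝ) ×ˢ Set.Ioi (t / 2) ∈ 𝓝 (r, t) :=
    (isOpen_univ.prod isOpen_Ioi).mem_nhds ⟨trivial, half_lt_self ht⟩
  refine (ContinuousOn.continuousAt (s := Set.univ ×ˢ Set.Ioi (t / 2)) ?_ hopen).continuousWithinAt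
  refine continuousOn_tsum (fun k => ?_) hU fun k p hp => h k p.1 p.2 (le_of_lt hp.2)
  fun_prop

theorem hasDerivAt_heatSeries_space {ψ : ℝ → ℝ} (hc : PolyBounded c) (hφ : ∀ x, |φ x| ≤ 1)
    (hψ : ∀ x, |ψ x| ≤ 1) (hd : ∀ x, HasDerivAt φ (ψ x) x) (r : ℝ) {t : ℝ} (ht : 0 < t) :
    HasDerivAt (fun r => heatSeries c φ r t)
      (heatSeries (fun k => c k * ((k + 1) * Real.pi)) ψ r t) r := by
  obtain ⟨U, hU, h⟩ := hc.mul_freq.exists_summable_bound hψ ht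
  refine hasDerivAt_tsum hU (fun k y => ?_) (fun k y => h k y t le_rfl)
    (summable_heatSeries hc hφ 0 ht) r
  have h1 : HasDerivAt (fun y : ℝ => ((k : ℝ) + 1) * Real.pi * y) ((k + 1) * Real.pi) y := by
    simpa using (hasDerivAt_id y).const_mul (((k : ℝ) + 1) * Real.pi)
  refine (((hd _).comp y h1).const_mul
    (c k * Real.exp (-(((k + 1) * Real.pi) ^ 2 / 2 * t)))).congr_deriv ?_
  ring

theorem hasDerivAt_heatSeries_time (hc : PolyBounded c) (hφ : ∀ x, |φ x| ≤ 1) (r : ℝ) {t : ℝ}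
    (ht : 0 < t) : HasDerivAt (fun t => heatSeries c φ r t)
      (1 / 2 * heatSeries (fun k => c k * ((k + 1) * Real.pi) * ((k + 1) * Real.pi))
        (fun x => -φ x) r t) t := by
  have hc2 := hc.mul_freq.mul_freq.const_mul (1 / 2)
  have hφ' : ∀ x, |-φ x| ≤ 1 := fun x => by rw [abs_neg]; exact hφ x
  obtain ⟨U, hU, h⟩ := hc2.exists_summable_bound hφ' (half_pos ht)
  have key := hasDerivAt_tsum_of_isPreconnected (t := Set.Ioi (t / 2)) (y₀ := t) (y := t)
    (g := fun (k : ℕ) s =>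
      c k * Real.exp (-(((k + 1) * Real.pi) ^ 2 / 2 * s)) * φ ((k + 1) * Real.pi * r))
    (g' := fun (k : ℕ) s => 1 / 2 * (c k * ((k + 1) * Real.pi) * ((k + 1) * Real.pi)) *
      Real.exp (-(((k + 1) * Real.pi) ^ 2 / 2 * s)) * -φ ((k + 1) * Real.pi * r))
    hU isOpen_Ioi isPreconnected_Ioi (fun k s _ => ?_) (fun k s hs => h k r s (le_of_lt hs))
    (half_lt_self ht) (summable_heatSeries hc hφ r ht) (half_lt_self ht)
  · refine key.congr_deriv ?_
    rw [heatSeries, ← tsum_mul_left]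
    exact tsum_congr fun k => by ring
  · have h1 : HasDerivAt (fun s : ℝ => -((((k : ℝ) + 1) * Real.pi) ^ 2 / 2 * s))
        (-(((k + 1) * Real.pi) ^ 2 / 2)) s := by
      simpa using ((hasDerivAt_id s).const_mul ((((k : ℝ) + 1) * Real.pi) ^ 2 / 2)).fun_neg
    refine ((h1.exp.const_mul (c k)).mul_const (φ ((k + 1) * Real.pi * r))).congr_deriv ?_
    ring

/-- A sine series plus an affine function is a heat solution once its boundedness and its initial
values are known. -/
theorem isHeatSolution_heatSeries {u₀ : ℝ → ℝ} {a b : ℝ} (hc : PolyBounded c)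
    (hbdd : ∃ C : ℝ, ∀ r ∈ Set.Icc (0 : ℝ) 1, ∀ t > 0,
      |(b - a) * r + a + heatSeries c Real.sin r t| ≤ C)
    (hinit : ∀ r ∈ Set.Ioo (0 : ℝ) 1,
      Tendsto (fun t => (b - a) * r + a + heatSeries c Real.sin r t) (𝓝[>] 0) (𝓝 (u₀ r))) :
    IsHeatSolution u₀ a b fun r t => (b - a) * r + a + heatSeries c Real.sin r t where
  bounded := hbdd
  continuousOn := by
    have h := (continuousOn_heatSeries hc Real.abs_sin_le_one Real.continuous_sin).mono
      (Set.prod_mono (Set.subset_univ (Set.Icc (0 : ℝ) 1)) subset_rfl)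
    exact (Continuous.continuousOn (by fun_prop : Continuous fun p : ℝ × ℝ =>
      (b - a) * p.1 + a)).add h
  equation := by
    have hneg : ∀ x, |-Real.sin x| ≤ 1 := fun x => by rw [abs_neg]; exact Real.abs_sin_le_one x
    refine ⟨fun r t => (b - a) + heatSeries (fun k => c k * ((k + 1) * Real.pi)) Real.cos r t,
      fun r t => heatSeries (fun k => c k * ((k + 1) * Real.pi) * ((k + 1) * Real.pi))
        (fun x => -Real.sin x) r t, ?_, fun r _ t ht => ⟨?_, ?_, ?_⟩⟩
    · exact (continuousOn_heatSeries hc.mul_freq.mul_freq hneg Real.continuous_sin.neg).mono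
        (Set.prod_mono (Set.subset_univ _) subset_rfl)
    · have h1 : HasDerivAt (fun r : ℝ => (b - a) * r + a) (b - a) r := by
        simpa using ((hasDerivAt_id r).const_mul (b - a)).add_const a
      exact (h1.fun_add (hasDerivAt_heatSeries_space hc Real.abs_sin_le_one Real.abs_cos_le_one
        Real.hasDerivAt_sin r ht)).hasDerivWithinAt
    · exact ((hasDerivAt_heatSeries_space hc.mul_freq Real.abs_cos_le_one hneg
        Real.hasDerivAt_cos r ht).const_add (b - a)).hasDerivWithinAt
    · exact (hasDerivAt_heatSeries_time hc Real.abs_sin_le_one r ht).const_add _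
  left_boundary t _ := by simp [heatSeries]
  right_boundary t _ := by
    have : ∀ k : ℕ, Real.sin ((k + 1) * Real.pi) = 0 := fun k => by
      exact_mod_cast Real.sin_nat_mul_pi (k + 1)
    simp [heatSeries, this]
  initial := hinit

end HeatSeries

/-! ### Uniqueness -/

/-- The `L²` distance of two heat solutions with the same data does not increase and vanishes as
`t ↓ 0`. -/
theorem IsHeatSolution.unique {u₀ : ℝ → ℝ} {a b : ℝ} {u w : ℝ → ℝ → ℝ}
    (hu : IsHeatSolution u₀ a b u) (hw : IsHeatSolution u₀ a b w) :
    ∀ r ∈ Set.Icc (0 : ℝ) 1, ∀ t > 0, w r t = u r t := by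
  obtain ⟨Cu, hCu⟩ := hu.bounded
  obtain ⟨Cw, hCw⟩ := hw.bounded
  obtain ⟨ur, urr, hurrc, hueq⟩ := hu.equation
  obtain ⟨wr, wrr, hwrrc, hweq⟩ := hw.equation
  set z : ℝ → ℝ → ℝ := fun r t => w r t - u r t with hz
  set zr : ℝ → ℝ → ℝ := fun r t => wr r t - ur r t with hzr
  set zrr : ℝ → ℝ → ℝ := fun r t => wrr r t - urr r t with hzrr
  have hI : Set.uIcc (0 : ℝ) 1 = Set.Icc 0 1 := Set.uIcc_of_le zero_le_one
  have hIoc : Set.uIoc (0 : ℝ) 1 = Set.Ioc 0 1 := Set.uIoc_of_le zero_le_one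
  have hzc : ContinuousOn (Function.uncurry z) (Set.Icc 0 1 ×ˢ Set.Ioi 0) :=
    hw.continuousOn.sub hu.continuousOn
  have hzrrc : ContinuousOn (Function.uncurry zrr) (Set.Icc 0 1 ×ˢ Set.Ioi 0) :=
    hwrrc.sub hurrc
  have hslice : ∀ {g : ℝ → ℝ → ℝ}, ContinuousOn (Function.uncurry g) (Set.Icc 0 1 ×ˢ Set.Ioi 0) →
      ∀ t > 0, ContinuousOn (fun r => g r t) (Set.Icc 0 1) := fun {g} hg t ht =>
    hg.comp (f := fun r : ℝ => (r, t)) (by fun_prop) fun r hr => ⟨hr, ht⟩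
  have hdr : ∀ r ∈ Set.Icc (0 : ℝ) 1, ∀ t > 0,
      HasDerivWithinAt (fun x => z x t) (zr r t) (Set.Icc 0 1) r := fun r hr t ht =>
    (hweq r hr t ht).1.sub (hueq r hr t ht).1
  have hdrr : ∀ r ∈ Set.Icc (0 : ℝ) 1, ∀ t > 0,
      HasDerivWithinAt (fun x => zr x t) (zrr r t) (Set.Icc 0 1) r := fun r hr t ht =>
    (hweq r hr t ht).2.1.sub (hueq r hr t ht).2.1
  have hdt : ∀ r ∈ Set.Icc (0 : ℝ) 1, ∀ t > 0,
      HasDerivAt (fun s => z r s) (1 / 2 * zrr r t) t := fun r hr t ht =>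
    ((hweq r hr t ht).2.2.fun_sub (hueq r hr t ht).2.2).congr_deriv (by rw [hzrr]; ring)
  have hz0 : ∀ t > 0, z 0 t = 0 := fun t ht => by
    simp [hz, hw.left_boundary t ht, hu.left_boundary t ht]
  have hz1 : ∀ t > 0, z 1 t = 0 := fun t ht => by
    simp [hz, hw.right_boundary t ht, hu.right_boundary t ht]
  set E : ℝ → ℝ := fun t => ∫ r in (0 : ℝ)..1, z r t ^ 2 with hE
  have hint : ∀ {g : ℝ → ℝ}, ContinuousOn g (Set.Icc 0 1) →
      IntervalIntegrable g volume 0 1 := fun {g} hg =>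
    ContinuousOn.intervalIntegrable (by rwa [hI])
  have hEd : ∀ t > 0, HasDerivAt E (∫ r in (0 : ℝ)..1, z r t * zrr r t) t := by
    intro t ht
    have hcomp : IsCompact (Set.Icc (0 : ℝ) 1 ×ˢ Set.Icc (t / 2) (2 * t)) :=
      isCompact_Icc.prod isCompact_Icc
    have hsub : Set.Icc (0 : ℝ) 1 ×ˢ Set.Icc (t / 2) (2 * t) ⊆ Set.Icc 0 1 ×ˢ Set.Ioi 0 :=
      Set.prod_mono subset_rfl fun s hs => lt_of_lt_of_le (half_pos ht) hs.1
    obtain ⟨B, hB⟩ := hcomp.exists_bound_of_continuousOn ((hzc.mul hzrrc).mono hsub)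
    refine (intervalIntegral.hasDerivAt_integral_of_dominated_loc_of_deriv_le
      (F := fun s r => z r s ^ 2) (F' := fun s r => z r s * zrr r s) (bound := fun _ => B)
      (s := Set.Icc (t / 2) (2 * t)) (Icc_mem_nhds (half_lt_self ht) (by linarith)) ?_ ?_ ?_ ?_ ?_
      ?_).2
    · filter_upwards [lt_mem_nhds ht] with s hs
      exact (hint ((hslice hzc s hs).pow 2)).def'.aestronglyMeasurable
    · exact hint ((hslice hzc t ht).pow 2)
    · exact (hint ((hslice hzc t ht).mul (hslice hzrrc t ht))).def'.aestronglyMeasurable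
    · refine Eventually.of_forall fun r hr s hs => ?_
      rw [hIoc] at hr
      exact hB (r, s) ⟨Set.Ioc_subset_Icc_self hr, hs⟩
    · exact intervalIntegrable_const
    · refine Eventually.of_forall fun r hr s hs => ?_
      rw [hIoc] at hr
      refine ((hdt r (Set.Ioc_subset_Icc_self hr) s
        (lt_of_lt_of_le (half_pos ht) hs.1)).fun_pow 2).congr_deriv ?_
      simp
      ring
  have hEneg : ∀ t > 0, ∫ r in (0 : ℝ)..1, z r t * zrr r t ≤ 0 := by
    intro t ht
    have hzrc : ContinuousOn (fun r => zr r t) (Set.Icc 0 1) := fun r hr =>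
      (hdrr r hr t ht).continuousWithinAt
    have h1 : IntervalIntegrable (fun r => zr r t ^ 2) volume 0 1 := hint (hzrc.pow 2)
    have h2 : IntervalIntegrable (fun r => z r t * zrr r t) volume 0 1 :=
      hint ((hslice hzc t ht).mul (hslice hzrrc t ht))
    have hftc := intervalIntegral.integral_eq_sub_of_hasDerivAt_of_le (zero_le_one' ℝ)
      (f := fun r => z r t * zr r t) (f' := fun r => zr r t ^ 2 + z r t * zrr r t)
      ((hslice hzc t ht).mul hzrc) (fun r hr => by
        have hn : Set.Icc (0 : ℝ) 1 ∈ 𝓝 r := Icc_mem_nhds hr.1 hr.2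
        have hr' := Set.Ioo_subset_Icc_self hr
        refine (((hdr r hr' t ht).hasDerivAt hn).mul
          ((hdrr r hr' t ht).hasDerivAt hn)).congr_deriv ?_
        ring) (h1.add h2)
    rw [intervalIntegral.integral_add h1 h2, hz0 t ht, hz1 t ht] at hftc
    have : 0 ≤ ∫ r in (0 : ℝ)..1, zr r t ^ 2 :=
      intervalIntegral.integral_nonneg zero_le_one fun r _ => sq_nonneg _
    linarith
  have hanti : AntitoneOn E (Set.Ioi 0) := by
    refine antitoneOn_of_deriv_nonpos (convex_Ioi 0)
      (fun t ht => (hEd t ht).continuousAt.continuousWithinAt) ?_ ?_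
    · rw [interior_Ioi]
      exact fun t ht => (hEd t ht).differentiableAt.differentiableWithinAt
    · rw [interior_Ioi]
      exact fun t ht => by rw [(hEd t ht).deriv]; exact hEneg t ht
  have hlim : Tendsto E (𝓝[>] 0) (𝓝 0) := by
    have := intervalIntegral.tendsto_integral_filter_of_dominated_convergence
      (μ := volume) (a := 0) (b := 1) (l := 𝓝[>] (0 : ℝ)) (F := fun t r => z r t ^ 2)
      (f := fun _ => (0 : ℝ)) (fun _ => (Cw + Cu) ^ 2) ?_ ?_ intervalIntegrable_const ?_
    · simpa using this
    · filter_upwards [self_mem_nhdsWithin] with s hs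
      exact (hint ((hslice hzc s hs).pow 2)).def'.aestronglyMeasurable
    · filter_upwards [self_mem_nhdsWithin] with s hs
      refine Eventually.of_forall fun r hr => ?_
      rw [hIoc] at hr
      have hr' := Set.Ioc_subset_Icc_self hr
      rw [norm_pow, Real.norm_eq_abs]
      gcongr
      exact (abs_sub _ _).trans (add_le_add (hCw r hr' s hs) (hCu r hr' s hs))
    · refine Eventually.of_forall fun r hr => ?_
      rw [hIoc] at hr
      rcases hr.2.eq_or_lt with rfl | hlt
      · refine tendsto_const_nhds.congr' ?_
        filter_upwards [self_mem_nhdsWithin] with s hs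
        rw [hz1 s hs]; simp
      · have := ((hw.initial r ⟨hr.1, hlt⟩).sub (hu.initial r ⟨hr.1, hlt⟩)).pow 2
        simpa using this
  intro r hr t ht
  by_contra hne
  have hpos : 0 < E t :=
    intervalIntegral.integral_pos zero_lt_one ((hslice hzc t ht).pow 2) (fun _ _ => sq_nonneg _)
      ⟨r, hr, sq_pos_of_ne_zero (sub_ne_zero.2 hne)⟩
  have : E t ≤ 0 := by
    refine ge_of_tendsto hlim ?_
    filter_upwards [Ioo_mem_nhdsGT ht] with s hs
    exact hanti hs.1 ht hs.2.le
  linarith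

/-! ### Scaling limits -/

theorem integral_comp_floor (F : ℕ → ℝ) (n : ℕ) :
    ∫ z in (0 : ℝ)..n, F ⌊z⌋₊ = ∑ y ∈ Finset.range n, F y := by
  have hae : ∀ y : ℕ, ∀ z ∈ Set.uIoo (y : ℝ) (y + 1 : ℕ), F ⌊z⌋₊ = F y := by
    intro y z hz
    rw [Set.uIoo_of_le (by push_cast; linarith)] at hz
    have : ⌊z⌋₊ = y := by
      rw [Nat.floor_eq_iff ((Nat.cast_nonneg y).trans hz.1.le)]
      exact ⟨hz.1.le, by exact_mod_cast hz.2⟩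
    rw [this]
  have hcongr : ∀ y : ℕ, ∫ z in (y : ℝ)..(y + 1 : ℕ), F ⌊z⌋₊ = F y := by
    intro y
    rw [intervalIntegral.integral_congr_uIoo (hae y)]
    simp
  have hint : ∀ y < n, IntervalIntegrable (fun z : ℝ => F ⌊z⌋₊) volume (y : ℝ) (y + 1 : ℕ) :=
    fun y _ => (intervalIntegrable_const (c := F y)).congr_uIoo fun z hz => (hae y z hz).symm
  have h := intervalIntegral.sum_integral_adjacent_intervals (a := fun y : ℕ => (y : ℝ)) hint
  rw [Nat.cast_zero] at h
  rw [← h]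
  exact Finset.sum_congr rfl fun y _ => hcongr y

/-- Riemann sums of bounded arrays converging pointwise on `(0, 1)`. -/
theorem tendsto_riemann_sum {h : ℕ → ℕ → ℝ} {g : ℝ → ℝ} {C : ℝ}
    (hC : ∀ N, ∀ y < N, |h N y| ≤ C)
    (hlim : ∀ z ∈ Set.Ioo (0 : ℝ) 1, Tendsto (fun N : ℕ => h N ⌊(N : ℝ) * z⌋₊) atTop (𝓝 (g z))) :
    Tendsto (fun N : ℕ => (∑ y ∈ Finset.range N, h N y) / N) atTop
      (𝓝 (∫ z in (0 : ℝ)..1, g z)) := by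
  have heq : ∀ᶠ N : ℕ in atTop, ∫ z in (0 : ℝ)..1, h N ⌊(N : ℝ) * z⌋₊
      = (∑ y ∈ Finset.range N, h N y) / N := by
    filter_upwards [eventually_gt_atTop 0] with N hN
    have hN' : (N : ℝ) ≠ 0 := by exact_mod_cast hN.ne'
    rw [intervalIntegral.integral_comp_mul_left (fun z => h N ⌊z⌋₊) hN', mul_zero, mul_one,
      integral_comp_floor, smul_eq_mul, inv_mul_eq_div]
  have hone : ∀ᵐ z : ℝ, z ≠ 1 := by simp [ae_iff]
  refine Tendsto.congr' heq ?_
  refine intervalIntegral.tendsto_integral_filter_of_dominated_convergence (fun _ => C) ?_ ?_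
    intervalIntegrable_const ?_
  · exact Eventually.of_forall fun N => ((measurable_from_nat (f := h N)).comp
      (Nat.measurable_floor.comp (measurable_const_mul (N : ℝ)))).aestronglyMeasurable
  · filter_upwards [eventually_gt_atTop 0] with N hN
    filter_upwards [hone] with z hz1 hz
    rw [Set.uIoc_of_le zero_le_one] at hz
    have hN' : (0 : ℝ) < N := by exact_mod_cast hN
    refine hC N _ ((Nat.floor_lt (by have := hz.1; positivity)).2 ?_)
    have : z < 1 := lt_of_le_of_ne hz.2 hz1
    nlinarith
  · filter_upwards [hone] with z hz1 hz
    rw [Set.uIoc_of_le zero_le_one] at hz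
    exact hlim z ⟨hz.1, lt_of_le_of_ne hz.2 hz1⟩

theorem tendsto_natCast_div_add_one : Tendsto (fun N : ℕ => (N : ℝ) / (N + 1)) atTop (𝓝 1) := by
  exact_mod_cast tendsto_natCast_div_add_atTop (1 : ℝ)

theorem tendsto_floor_div {r : ℝ} (hr : 0 ≤ r) :
    Tendsto (fun N : ℕ => (⌊(N : ℝ) * r⌋₊ : ℝ) / N) atTop (𝓝 r) := by
  have := (tendsto_nat_floor_mul_div_atTop (R := ℝ) hr).comp tendsto_natCast_atTop_atTop
  simpa only [Function.comp_def, mul_comm r] using this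

theorem tendsto_floor_div_add_one {r : ℝ} (hr : 0 ≤ r) :
    Tendsto (fun N : ℕ => (⌊(N : ℝ) * r⌋₊ : ℝ) / (N + 1)) atTop (𝓝 r) := by
  have := (tendsto_floor_div hr).mul tendsto_natCast_div_add_one
  rw [mul_one] at this
  refine this.congr' ?_
  filter_upwards [eventually_gt_atTop 0] with N hN
  have hN' : (N : ℝ) ≠ 0 := by exact_mod_cast hN.ne'
  field_simp

theorem tendsto_one_sub_cos_mul_sq (a : ℝ) :
    Tendsto (fun N : ℕ => (1 - Real.cos (a / (N + 1))) * (N : ℝ) ^ 2) atTop (𝓝 (a ^ 2 / 2)) := by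
  have hy : Tendsto (fun N : ℕ => a / 2 / ((N : ℝ) + 1)) atTop (𝓝 0) :=
    tendsto_const_nhds.div_atTop (tendsto_atTop_add_const_right _ _ tendsto_natCast_atTop_atTop)
  have hsinc := (Real.continuous_sinc.tendsto 0).comp hy
  rw [Real.sinc_zero] at hsinc
  have := ((tendsto_natCast_div_add_one.const_mul (a / 2)).mul hsinc).pow 2 |>.const_mul 2
  have hlim : 2 * (a / 2 * 1 * 1) ^ 2 = a ^ 2 / 2 := by ring
  rw [hlim] at this
  refine this.congr fun N => ?_
  have hN : (N : ℝ) + 1 ≠ 0 := by positivity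
  have hcos : a / ((N : ℝ) + 1) = 2 * (a / 2 / (N + 1)) := by ring
  have hsin : Real.sin (a / 2 / ((N : ℝ) + 1))
      = a / 2 / (N + 1) * Real.sinc (a / 2 / (N + 1)) := by
    by_cases h0 : a / 2 / ((N : ℝ) + 1) = 0
    · simp [h0]
    · rw [Real.sinc_of_ne_zero h0, mul_div_cancel₀ _ h0]
  have hc := Real.sin_sq_eq_half_sub (a / 2 / ((N : ℝ) + 1))
  rw [hcos, show 1 - Real.cos (2 * (a / 2 / ((N : ℝ) + 1)))
    = 2 * Real.sin (a / 2 / ((N : ℝ) + 1)) ^ 2 by rw [hc]; ring, hsin, Function.comp_apply]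
  ring

/-- Dominated convergence for the discrete sine series. -/
theorem tendsto_sum_sineMode {d : ℕ → ℕ → ℝ} (hd : ∀ N, ∀ y < N, |d N (y + 1)| ≤ 1)
    {x : ℕ → ℕ} {s : ℕ → ℝ} {q : ℝ} (hq : 0 < q) (hs : ∀ N, 0 ≤ s N)
    (hqs : ∀ᶠ N : ℕ in atTop, q * ((N : ℝ) + 1) ^ 2 ≤ 2 * s N) {f : ℕ → ℝ}
    (hlim : ∀ k, Tendsto (fun N => sineMode N (d N) k (x N) (s N)) atTop (𝓝 (f k))) :
    Tendsto (fun N => ∑ k ∈ Finset.range N, sineMode N (d N) k (x N) (s N)) atTop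
      (𝓝 (∑' k, f k)) := by
  have hsum : Summable fun k : ℕ => 2 * Real.exp (-(((k : ℝ) + 1) * q)) := by
    have h1 := (Real.summable_exp_nat_mul_iff (a := -q)).2 (by linarith)
    refine (((summable_nat_add_iff 1).2 h1).mul_left 2).congr fun k => ?_
    push_cast
    ring_nf
  have key := tendsto_tsum_of_dominated_convergence
    (f := fun N k => if k < N then sineMode N (d N) k (x N) (s N) else 0) (g := f)
    (𝓕 := atTop) hsum (fun k => (hlim k).congr' ?_) ?_
  · refine key.congr fun N => ?_
    rw [tsum_eq_sum (s := Finset.range N) fun k hk => if_neg (by simpa using hk)]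
    exact Finset.sum_congr rfl fun k hk => if_pos (Finset.mem_range.1 hk)
  · filter_upwards [eventually_gt_atTop k] with N hN
    rw [if_pos hN]
  · filter_upwards [hqs] with N hN k
    split_ifs with hk
    · exact abs_sineMode_le (hd N) hk _ (hs N) hN
    · rw [norm_zero]; positivity

section Limits

variable {u₀ : ℝ → ℝ} {a b : ℝ} {M : ℕ → ℝ} {R : ℕ → ℕ → ℝ → ℝ}

/-- The limits of the reservoir densities, as long as the integrated currents are negligible. -/
theorem tendsto_reservoirs (hM : ∀ N, 1 ≤ N → 0 < M N)
    (hR : ∀ N, 1 ≤ N → DensitySystem N (M N) (R N))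
    (hl : Tendsto (fun N => R N 0 0) atTop (𝓝 a))
    (hr : Tendsto (fun N => R N (N + 1) 0) atTop (𝓝 b)) {s : ℕ → ℝ} (hs : ∀ N, 0 ≤ s N)
    (hsM : Tendsto (fun N : ℕ => ((N : ℝ) + s N / (2 * (N + 1))) / M N) atTop (𝓝 0)) :
    Tendsto (fun N => R N 0 (s N)) atTop (𝓝 a) ∧
      Tendsto (fun N => R N (N + 1) (s N)) atTop (𝓝 b) := by
  constructor
  · have : Tendsto (fun N => R N 0 (s N) - R N 0 0) atTop (𝓝 0) :=
      squeeze_zero_norm' (by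
        filter_upwards [eventually_ge_atTop 1] with N hN
        exact (hR N hN).abs_left_sub_le (hM N hN) (hs N)) hsM
    simpa using this.add hl
  · have : Tendsto (fun N => R N (N + 1) (s N) - R N (N + 1) 0) atTop (𝓝 0) :=
      squeeze_zero_norm' (by
        filter_upwards [eventually_ge_atTop 1] with N hN
        exact (hR N hN).abs_right_sub_le (hM N hN) (hs N)) hsM
    simpa using this.add hr

/-- Initial deviation from the affine stationary profile. -/
noncomputable def deviation (R : ℕ → ℕ → ℝ → ℝ) (a b : ℝ) (N y : ℕ) : ℝ :=
  R N y 0 - ((b - a) * (y / (N + 1)) + a)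

theorem abs_deviation_le (ha : a ∈ Set.Icc (0 : ℝ) 1) (hb : b ∈ Set.Icc (0 : ℝ) 1)
    (hR : ∀ N, 1 ≤ N → DensitySystem N (M N) (R N)) (N y : ℕ) (hy : y < N) :
    |deviation R a b N (y + 1)| ≤ 1 := by
  obtain ⟨h1, h2⟩ := (hR N (by omega)).mem_Icc (y + 1) 0 le_rfl
  have hθ0 : 0 ≤ ((y + 1 : ℕ) : ℝ) / (N + 1) := by positivity
  have hθ1 : ((y + 1 : ℕ) : ℝ) / (N + 1) ≤ 1 := by
    rw [div_le_one (by positivity)]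
    exact_mod_cast (by omega : y + 1 ≤ N + 1)
  obtain ⟨ha0, ha1⟩ := ha
  obtain ⟨hb0, hb1⟩ := hb
  rw [deviation, abs_le]
  set θ := ((y + 1 : ℕ) : ℝ) / (N + 1)
  constructor <;> nlinarith [mul_nonneg hθ0 hb0, mul_nonneg (sub_nonneg.2 hθ1) ha0,
    mul_nonneg hθ0 (sub_nonneg.2 hb1), mul_nonneg (sub_nonneg.2 hθ1) (sub_nonneg.2 ha1)]

/-- The density is asymptotically the affine profile plus the discrete sine series. -/
theorem tendsto_density_of_series (hM : ∀ N, 1 ≤ N → 0 < M N)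
    (hR : ∀ N, 1 ≤ N → DensitySystem N (M N) (R N))
    (hl : Tendsto (fun N => R N 0 0) atTop (𝓝 a))
    (hr : Tendsto (fun N => R N (N + 1) 0) atTop (𝓝 b)) {s : ℕ → ℝ} (hs : ∀ N, 0 ≤ s N)
    (hsM : Tendsto (fun N : ℕ => ((N : ℝ) + s N / (2 * (N + 1))) / M N) atTop (𝓝 0))
    {r : ℝ} (hr01 : r ∈ Set.Icc (0 : ℝ) 1) {ℓ : ℝ}
    (hser : Tendsto (fun N : ℕ => ∑ k ∈ Finset.range N,
      sineMode N (deviation R a b N) k ⌊(N : ℝ) * r⌋₊ (s N)) atTop (𝓝 ℓ)) :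
    Tendsto (fun N : ℕ => R N ⌊(N : ℝ) * r⌋₊ (s N)) atTop (𝓝 ((b - a) * r + a + ℓ)) := by
  have herr : Tendsto (fun N : ℕ => |R N 0 0 - a| + |R N (N + 1) 0 - b|
      + ((N : ℝ) + s N / (2 * (N + 1))) / M N) atTop (𝓝 0) := by
    simpa using (((hl.sub_const a).abs).add ((hr.sub_const b).abs)).add hsM
  have hdiff : Tendsto (fun N : ℕ => R N ⌊(N : ℝ) * r⌋₊ (s N)
      - ((b - a) * (⌊(N : ℝ) * r⌋₊ / (N + 1)) + a + ∑ k ∈ Finset.range N,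
        sineMode N (deviation R a b N) k ⌊(N : ℝ) * r⌋₊ (s N))) atTop (𝓝 0) := by
    refine squeeze_zero_norm' ?_ herr
    filter_upwards [eventually_ge_atTop 1] with N hN
    have hMN := hM N hN
    have hmono : ∀ t ∈ Set.Icc 0 (s N), ((N : ℝ) + t / (2 * (N + 1))) / M N
        ≤ ((N : ℝ) + s N / (2 * (N + 1))) / M N := fun t ht => by
      gcongr
      exact ht.2
    refine (hR N hN).abs_sub_sineSeries_le (T := s N) (fun t ht => ?_) (fun t ht => ?_) ?_
      ⟨hs N, le_rfl⟩
    · have h1 := abs_sub_le (R N 0 t) (R N 0 0) a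
      have h2 := (hR N hN).abs_left_sub_le hMN ht.1
      linarith [hmono t ht, abs_nonneg (R N (N + 1) 0 - b)]
    · have h1 := abs_sub_le (R N (N + 1) t) (R N (N + 1) 0) b
      have h2 := (hR N hN).abs_right_sub_le hMN ht.1
      linarith [hmono t ht, abs_nonneg (R N 0 0 - a)]
    · refine (Nat.floor_le_of_le ?_).trans (Nat.le_succ N)
      exact mul_le_of_le_one_right (Nat.cast_nonneg N) hr01.2
  have hmain := hdiff.add ((((tendsto_floor_div_add_one hr01.1).const_mul (b - a)).add_const a).add
    hser)
  rw [zero_add] at hmain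
  exact hmain.congr fun N => by ring

/-- Sine coefficients of the initial deviation from the affine profile. -/
noncomputable def limitCoeff (u₀ : ℝ → ℝ) (a b : ℝ) (k : ℕ) : ℝ :=
  2 * ∫ z in (0 : ℝ)..1, (u₀ z - ((b - a) * z + a)) * Real.sin ((k + 1) * Real.pi * z)

theorem tendsto_sineCoeff (hu₀ : ContinuousOn u₀ (Set.Ioo 0 1))
    (ha : a ∈ Set.Icc (0 : ℝ) 1) (hb : b ∈ Set.Icc (0 : ℝ) 1)
    (hR : ∀ N, 1 ≤ N → DensitySystem N (M N) (R N))
    (hinit : ∀ N x, x < N → R N (x + 1) 0 = u₀ (((x : ℝ) + 1) / N)) (k : ℕ) :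
    Tendsto (fun N => sineCoeff N (deviation R a b N) k) atTop (𝓝 (limitCoeff u₀ a b k)) := by
  have hriem := tendsto_riemann_sum (C := 1)
    (h := fun N y => deviation R a b N (y + 1) *
      Real.sin ((k + 1) * Real.pi * ((y + 1 : ℕ) / (N + 1))))
    (g := fun z => (u₀ z - ((b - a) * z + a)) * Real.sin ((k + 1) * Real.pi * z)) ?_ ?_
  · have := (tendsto_natCast_div_add_one.mul hriem).const_mul 2
    rw [one_mul] at this
    refine this.congr' ?_
    filter_upwards [eventually_gt_atTop 0] with N hN
    have hN' : (N : ℝ) ≠ 0 := by exact_mod_cast hN.ne'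
    rw [sineCoeff]
    field_simp
  · intro N y hy
    rw [abs_mul]
    exact mul_le_one₀ (abs_deviation_le ha hb hR N y hy) (abs_nonneg _) (Real.abs_sin_le_one _)
  · intro z hz
    have h1 : Tendsto (fun N : ℕ => ((⌊(N : ℝ) * z⌋₊ : ℝ) + 1) / N) atTop (𝓝 z) := by
      have := (tendsto_floor_div hz.1.le).add tendsto_one_div_atTop_nhds_zero_nat
      rw [add_zero] at this
      exact this.congr fun N => by rw [← add_div]
    have h2 : Tendsto (fun N : ℕ => ((⌊(N : ℝ) * z⌋₊ + 1 : ℕ) : ℝ) / (N + 1)) atTop (𝓝 z) := by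
      have := (tendsto_floor_div_add_one hz.1.le).add tendsto_one_div_add_atTop_nhds_zero_nat
      rw [add_zero] at this
      exact this.congr fun N => by push_cast; rw [← add_div]
    have h3 : Tendsto (fun N : ℕ => R N (⌊(N : ℝ) * z⌋₊ + 1) 0) atTop (𝓝 (u₀ z)) := by
      refine (((hu₀.continuousAt (isOpen_Ioo.mem_nhds hz)).tendsto.comp h1)).congr' ?_
      filter_upwards [eventually_gt_atTop 0] with N hN
      have hN' : (0 : ℝ) < N := by exact_mod_cast hN
      have hlt : ⌊(N : ℝ) * z⌋₊ < N :=
        (Nat.floor_lt (by have := hz.1; positivity)).2 (by nlinarith [hz.2])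
      rw [hinit N _ hlt, Function.comp_apply]
    exact (h3.sub ((h2.const_mul (b - a)).add_const a)).mul
      ((Real.continuous_sin.tendsto _).comp (h2.const_mul ((k + 1) * Real.pi)))

theorem polyBounded_limitCoeff (hu₀ : ContinuousOn u₀ (Set.Ioo 0 1))
    (ha : a ∈ Set.Icc (0 : ℝ) 1) (hb : b ∈ Set.Icc (0 : ℝ) 1)
    (hR : ∀ N, 1 ≤ N → DensitySystem N (M N) (R N))
    (hinit : ∀ N x, x < N → R N (x + 1) 0 = u₀ (((x : ℝ) + 1) / N)) :
    PolyBounded (limitCoeff u₀ a b) :=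
  ⟨2, 0, fun k => by
    rw [pow_zero, mul_one]
    exact le_of_tendsto (tendsto_sineCoeff hu₀ ha hb hR hinit k).abs
      (Eventually.of_forall fun N => abs_sineCoeff_le (abs_deviation_le ha hb hR N) k)⟩

/-- Convergence on the diffusive time scale. -/
theorem tendsto_density_diffusive (hu₀ : ContinuousOn u₀ (Set.Ioo 0 1))
    (ha : a ∈ Set.Icc (0 : ℝ) 1) (hb : b ∈ Set.Icc (0 : ℝ) 1)
    (hM : ∀ N, 1 ≤ N → 0 < M N) (hR : ∀ N, 1 ≤ N → DensitySystem N (M N) (R N))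
    (hinit : ∀ N x, x < N → R N (x + 1) 0 = u₀ (((x : ℝ) + 1) / N))
    (hl : Tendsto (fun N => R N 0 0) atTop (𝓝 a))
    (hr : Tendsto (fun N => R N (N + 1) 0) atTop (𝓝 b)) {t : ℝ} (ht : 0 < t)
    (hsM : Tendsto (fun N : ℕ => ((N : ℝ) + (N : ℝ) ^ 2 * t / (2 * (N + 1))) / M N) atTop (𝓝 0))
    {r : ℝ} (hr01 : r ∈ Set.Icc (0 : ℝ) 1) :
    Tendsto (fun N : ℕ => R N ⌊(N : ℝ) * r⌋₊ ((N : ℝ) ^ 2 * t)) atTop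
      (𝓝 ((b - a) * r + a + heatSeries (limitCoeff u₀ a b) Real.sin r t)) := by
  have hs : ∀ N : ℕ, 0 ≤ (N : ℝ) ^ 2 * t := fun N => by positivity
  refine tendsto_density_of_series hM hR hl hr hs hsM hr01 ?_
  refine tendsto_sum_sineMode (abs_deviation_le ha hb hR) (half_pos ht) hs ?_ fun k => ?_
  · filter_upwards [eventually_ge_atTop 1] with N hN
    have hN' : (1 : ℝ) ≤ N := by exact_mod_cast hN
    have : ((N : ℝ) + 1) ^ 2 ≤ (2 * N) ^ 2 := by gcongr; linarith
    nlinarith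
  · have hexp := (((tendsto_one_sub_cos_mul_sq ((k + 1) * Real.pi)).mul_const t).neg)
    refine ((tendsto_sineCoeff hu₀ ha hb hR hinit k).mul
      ((Real.continuous_exp.tendsto _).comp (hexp.congr fun N => ?_))).mul
      ((Real.continuous_sin.tendsto _).comp
        ((tendsto_floor_div_add_one hr01.1).const_mul ((k + 1) * Real.pi)))
    ring

/-- Convergence to the stationary profile on longer time scales. -/
theorem tendsto_density_superdiffusive (ha : a ∈ Set.Icc (0 : ℝ) 1) (hb : b ∈ Set.Icc (0 : ℝ) 1)
    (hM : ∀ N, 1 ≤ N → 0 < M N) (hR : ∀ N, 1 ≤ N → DensitySystem N (M N) (R N))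
    (hl : Tendsto (fun N => R N 0 0) atTop (𝓝 a))
    (hr : Tendsto (fun N => R N (N + 1) 0) atTop (𝓝 b)) {s : ℕ → ℝ} (hs : ∀ N, 0 ≤ s N)
    (hsN : Tendsto (fun N : ℕ => 2 * s N / ((N : ℝ) + 1) ^ 2) atTop atTop)
    (hsM : Tendsto (fun N : ℕ => ((N : ℝ) + s N / (2 * (N + 1))) / M N) atTop (𝓝 0))
    {r : ℝ} (hr01 : r ∈ Set.Icc (0 : ℝ) 1) :
    Tendsto (fun N : ℕ => R N ⌊(N : ℝ) * r⌋₊ (s N)) atTop (𝓝 ((b - a) * r + a)) := by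
  have hser : Tendsto (fun N : ℕ => ∑ k ∈ Finset.range N,
      sineMode N (deviation R a b N) k ⌊(N : ℝ) * r⌋₊ (s N)) atTop (𝓝 (∑' _ : ℕ, (0 : ℝ))) := by
    refine tendsto_sum_sineMode (abs_deviation_le ha hb hR) one_pos hs ?_ fun k => ?_
    · filter_upwards [hsN.eventually_ge_atTop 1] with N hN
      rwa [le_div_iff₀ (by positivity)] at hN
    · have hzero : Tendsto (fun N : ℕ =>
          2 * Real.exp (-(((k : ℝ) + 1) * (2 * s N / ((N : ℝ) + 1) ^ 2)))) atTop (𝓝 0) := by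
        have := (Real.tendsto_exp_neg_atTop_nhds_zero.comp
          (hsN.const_mul_atTop (by positivity : (0 : ℝ) < k + 1))).const_mul 2
        simpa [Function.comp_def] using this
      refine squeeze_zero_norm' ?_ hzero
      filter_upwards [eventually_gt_atTop k] with N hN
      refine abs_sineMode_le (abs_deviation_le ha hb hR N) hN _ (hs N) (le_of_eq ?_)
      field_simp
  rw [tsum_zero] at hser
  simpa using tendsto_density_of_series hM hR hl hr hs hsM hr01 hser

/-- The limit of the densities takes the right initial values. -/
theorem tendsto_initial (hu₀ : ContinuousOn u₀ (Set.Ioo 0 1))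
    (hmem : ∀ r ∈ Set.Ioo (0 : ℝ) 1, u₀ r ∈ Set.Icc (0 : ℝ) 1)
    (hR : ∀ N, 1 ≤ N → DensitySystem N (M N) (R N))
    (hinit : ∀ N x, x < N → R N (x + 1) 0 = u₀ (((x : ℝ) + 1) / N))
    {r : ℝ} (hr : r ∈ Set.Ioo (0 : ℝ) 1) {v : ℝ → ℝ}
    (hv : ∀ t > 0, Tendsto (fun N : ℕ => R N ⌊(N : ℝ) * r⌋₊ ((N : ℝ) ^ 2 * t)) atTop (𝓝 (v t))) :
    Tendsto v (𝓝[>] 0) (𝓝 (u₀ r)) := by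
  have hest : ∀ e > 0, ∃ δ > 0, ∀ t > 0, |v t - u₀ r| ≤ e + t / δ ^ 2 := by
    intro e he
    obtain ⟨δ₀, hδ₀, hcont⟩ :=
      Metric.continuousAt_iff.1 (hu₀.continuousAt (isOpen_Ioo.mem_nhds hr)) e he
    obtain ⟨δ, hδ, h0, h1, h2⟩ : ∃ δ > 0, δ ≤ δ₀ ∧ δ ≤ r ∧ δ ≤ 1 - r :=
      ⟨min δ₀ (min r (1 - r)), lt_min hδ₀ (lt_min hr.1 (by linarith [hr.2])), min_le_left _ _,
        (min_le_right _ _).trans (min_le_left _ _), (min_le_right _ _).trans (min_le_right _ _)⟩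
    refine ⟨δ, hδ, fun t ht => ?_⟩
    have hnear : ∀ N x : ℕ, x < N → |((x : ℝ) + 1) / N - r| < δ → |R N (x + 1) 0 - u₀ r| < e :=
      fun N x hx hxr => by rw [hinit N x hx]; exact hcont (hxr.trans_le h0)
    have hbar : Tendsto (fun N : ℕ => (((⌊(N : ℝ) * r⌋₊ : ℝ) / N - r) ^ 2
        + (N : ℝ) ^ 2 * t / N ^ 2) / δ ^ 2) atTop (𝓝 (t / δ ^ 2)) := by
      have := ((((tendsto_floor_div hr.1.le).sub_const r).pow 2).add_const t).div_const (δ ^ 2)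
      rw [sub_self, zero_pow two_ne_zero, zero_add] at this
      refine this.congr' ?_
      filter_upwards [eventually_gt_atTop 0] with N hN
      have hN' : (N : ℝ) ≠ 0 := by exact_mod_cast hN.ne'
      field_simp
    have hfl : ∀ N : ℕ, ⌊(N : ℝ) * r⌋₊ ≤ N + 1 := fun N =>
      (Nat.floor_le_of_le (mul_le_of_le_one_right (Nat.cast_nonneg N) hr.2.le)).trans
        (Nat.le_succ N)
    have hup : v t ≤ u₀ r + e + t / δ ^ 2 := by
      refine le_of_tendsto_of_tendsto (hv t ht) (hbar.const_add (u₀ r + e)) ?_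
      filter_upwards [eventually_ge_atTop 1] with N hN
      exact (hR N hN).le_of_le_near (by linarith [(hmem r hr).1]) hN hδ h1 h2
        (fun x hx hxr => by linarith [(abs_lt.1 (hnear N x hx hxr)).2]) (hfl N) (by positivity)
    have hlo : u₀ r - e - t / δ ^ 2 ≤ v t := by
      refine le_of_tendsto_of_tendsto (hbar.const_sub (u₀ r - e)) (hv t ht) ?_
      filter_upwards [eventually_ge_atTop 1] with N hN
      exact (hR N hN).le_of_ge_near (by linarith [(hmem r hr).2]) hN hδ h1 h2
        (fun x hx hxr => by linarith [(abs_lt.1 (hnear N x hx hxr)).1]) (hfl N) (by positivity)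
    rw [abs_le]
    constructor <;> linarith
  rw [Metric.tendsto_nhds]
  intro e he
  obtain ⟨δ, hδ, h⟩ := hest (e / 2) (half_pos he)
  have hpos : 0 < e / 2 * δ ^ 2 := by positivity
  filter_upwards [Ioo_mem_nhdsGT hpos] with t ht
  have h1 : t / δ ^ 2 < e / 2 := by rw [div_lt_iff₀ (by positivity)]; exact ht.2
  rw [Real.dist_eq]
  linarith [h t ht.1]

end Limits

/-! ### Size of the reservoirs -/

theorem half_rpow_le_reservoirSize {α : ℝ} (hα : 0 < α) {N : ℕ} (hN : 1 ≤ N) :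
    (N : ℝ) ^ (1 + α) / 2 ≤ reservoirSize α N := by
  have hN' : (1 : ℝ) ≤ N := by exact_mod_cast hN
  have h1 : 1 ≤ (N : ℝ) ^ (1 + α) := Real.one_le_rpow hN' (by linarith)
  have h2 := Nat.lt_floor_add_one ((N : ℝ) ^ (1 + α))
  have h3 : (1 : ℝ) ≤ ⌊(N : ℝ) ^ (1 + α)⌋₊ := by
    exact_mod_cast Nat.le_floor (by exact_mod_cast h1)
  rw [reservoirSize]
  linarith

theorem reservoirSize_pos {α : ℝ} (hα : 0 < α) {N : ℕ} (hN : 1 ≤ N) : 0 < reservoirSize α N := by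
  have h := half_rpow_le_reservoirSize hα hN
  have hN' : (0 : ℝ) < N := by exact_mod_cast hN
  have : 0 < (N : ℝ) ^ (1 + α) / 2 := by positivity
  exact_mod_cast this.trans_le h

/-- The integrated currents up to the time `N ^ (2 + β) t` are negligible if `β < α`. -/
theorem tendsto_current_div_reservoirSize {α β : ℝ} (hα : 0 < α) (hβ : 0 ≤ β) (hβα : β < α)
    {t : ℝ} (ht : 0 ≤ t) :
    Tendsto (fun N : ℕ => ((N : ℝ) + (N : ℝ) ^ (2 + β) * t / (2 * (N + 1))) / reservoirSize α N)
      atTop (𝓝 0) := by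
  have hlim : Tendsto (fun N : ℕ => (2 + t) * (N : ℝ) ^ (-(α - β))) atTop (𝓝 0) := by
    simpa using ((tendsto_rpow_neg_atTop (by linarith : 0 < α - β)).comp
      tendsto_natCast_atTop_atTop).const_mul (2 + t)
  refine squeeze_zero' (Eventually.of_forall fun N => by positivity) ?_ hlim
  filter_upwards [eventually_ge_atTop 1] with N hN
  have hN' : (1 : ℝ) ≤ N := by exact_mod_cast hN
  have hN0 : (0 : ℝ) < N := by linarith
  have h1 : (N : ℝ) ≤ (N : ℝ) ^ (1 + β) := by
    simpa using Real.rpow_le_rpow_of_exponent_le hN' (by linarith : (1 : ℝ) ≤ 1 + β)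
  have h2 : (N : ℝ) ^ (2 + β) * t / (2 * (N + 1)) ≤ (N : ℝ) ^ (1 + β) * (t / 2) := by
    have : (N : ℝ) ^ (2 + β) = N * (N : ℝ) ^ (1 + β) := by
      rw [← Real.rpow_one_add' hN0.le (by linarith)]; ring_nf
    rw [this, div_le_iff₀ (by positivity)]
    have : 0 ≤ (N : ℝ) ^ (1 + β) * t := by positivity
    nlinarith
  have hsplit : (N : ℝ) ^ (-(α - β)) * (N : ℝ) ^ (1 + α) = (N : ℝ) ^ (1 + β) := by
    rw [← Real.rpow_add hN0]; ring_nf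
  have hres := half_rpow_le_reservoirSize hα hN
  rw [div_le_iff₀ (by exact_mod_cast reservoirSize_pos hα hN)]
  calc (N : ℝ) + (N : ℝ) ^ (2 + β) * t / (2 * (N + 1))
      ≤ (N : ℝ) ^ (1 + β) + (N : ℝ) ^ (1 + β) * (t / 2) := add_le_add h1 h2
    _ = (2 + t) * (N : ℝ) ^ (-(α - β)) * ((N : ℝ) ^ (1 + α) / 2) := by rw [← hsplit]; ring
    _ ≤ _ := by gcongr

theorem tendsto_rpow_mul_div_sq {β t : ℝ} (hβ : 0 < β) (ht : 0 < t) :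
    Tendsto (fun N : ℕ => 2 * ((N : ℝ) ^ (2 + β) * t) / ((N : ℝ) + 1) ^ 2) atTop atTop := by
  have hlim : Tendsto (fun N : ℕ => t / 2 * (N : ℝ) ^ β) atTop atTop :=
    ((tendsto_rpow_atTop hβ).comp tendsto_natCast_atTop_atTop).const_mul_atTop (half_pos ht)
  refine tendsto_atTop_mono' _ ?_ hlim
  filter_upwards [eventually_ge_atTop 1] with N hN
  have hN' : (1 : ℝ) ≤ N := by exact_mod_cast hN
  have hN0 : (0 : ℝ) < N := by linarith
  rw [le_div_iff₀ (by positivity), Real.rpow_add hN0, Real.rpow_two]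
  have h1 : ((N : ℝ) + 1) ^ 2 ≤ (2 * N) ^ 2 := by gcongr; linarith
  have h2 : 0 ≤ t / 2 * (N : ℝ) ^ β := by positivity
  nlinarith [mul_le_mul_of_nonneg_left h1 h2]

end Channel

theorem mainTheorem2
    (α : ℝ) (hα : 0 < α)
    (u₀ : ℝ → ℝ) (hu₀ : ContinuousOn u₀ (Set.Ioo 0 1))
    (hu₀_mem : ∀ r ∈ Set.Ioo (0 : ℝ) 1, u₀ r ∈ Set.Icc (0 : ℝ) 1)
    (vMinus vPlus : ℝ) (hvMinus : vMinus ∈ Set.Icc (0 : ℝ) 1) (hvPlus : vPlus ∈ Set.Icc (0 : ℝ) 1)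
    -- for each `N ≥ 1`, the process with reservoirs of size `N ^ (1 + α)`
    (Ω : ℕ → Type*) [∀ N, MeasurableSpace (Ω N)]
    (P : ∀ N, Measure (Ω N)) [∀ N, IsProbabilityMeasure (P N)]
    (X : ∀ N, ℝ≥0 → Ω N → Channel.State N (Channel.reservoirSize α N))
    (hX : ∀ N, 1 ≤ N →
      Channel.IsMarkovProcess (Channel.generator N (Channel.reservoirSize α N)) (P N) (X N))
    -- initial state: `n_±(0) / M → v_±` in probability and `ρ(x, 0) = u₀(x / N)` in the channel
    (hInitMinus : ∀ δ > 0, Tendsto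
      (fun N => P N {ω | δ ≤ |((X N 0 ω).2.1 : ℝ) / Channel.reservoirSize α N - vMinus|})
      atTop (𝓝 0))
    (hInitPlus : ∀ δ > 0, Tendsto
      (fun N => P N {ω | δ ≤ |((X N 0 ω).2.2 : ℝ) / Channel.reservoirSize α N - vPlus|})
      atTop (𝓝 0))
    (hInit : ∀ N x : ℕ, 1 ≤ x → x ≤ N → Channel.rho (P N) (X N) x 0 = u₀ ((x : ℝ) / N)) :
    -- a)
    ((∃ u : ℝ → ℝ → ℝ, Channel.IsHeatSolution u₀ vMinus vPlus u ∧
        (∀ w : ℝ → ℝ → ℝ, Channel.IsHeatSolution u₀ vMinus vPlus w →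
          ∀ r ∈ Set.Icc (0 : ℝ) 1, ∀ t > 0, w r t = u r t) ∧
        ∀ r ∈ Set.Icc (0 : ℝ) 1, ∀ t : ℝ≥0, 0 < t →
          Tendsto (fun N : ℕ => Channel.rho (P N) (X N) ⌊(N : ℝ) * r⌋₊ ((N : ℝ≥0) ^ 2 * t))
            atTop (𝓝 (u r t))) ∧
      ∀ t : ℝ≥0, 0 < t →
        Tendsto (fun N : ℕ => Channel.rho (P N) (X N) 0 ((N : ℝ≥0) ^ 2 * t))
          atTop (𝓝 vMinus) ∧
        Tendsto (fun N : ℕ => Channel.rho (P N) (X N) (N + 1) ((N : ℝ≥0) ^ 2 * t))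
          atTop (𝓝 vPlus)) ∧
    -- b)
    (∀ α' : ℝ, 0 < α' → α' < α → ∀ t : ℝ≥0, 0 < t →
      (∀ r ∈ Set.Icc (0 : ℝ) 1,
        Tendsto (fun N : ℕ =>
            Channel.rho (P N) (X N) ⌊(N : ℝ) * r⌋₊ ((N : ℝ≥0) ^ (2 + α') * t))
          atTop (𝓝 ((vPlus - vMinus) * r + vMinus))) ∧
      Tendsto (fun N : ℕ => Channel.rho (P N) (X N) 0 ((N : ℝ≥0) ^ (2 + α') * t))
        atTop (𝓝 vMinus) ∧
      Tendsto (fun N : ℕ => Channel.rho (P N) (X N) (N + 1) ((N : ℝ≥0) ^ (2 + α') * t))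
        atTop (𝓝 vPlus)) := by
  have hex : ∀ N, ∃ R : ℕ → ℝ → ℝ, 1 ≤ N →
      Channel.DensitySystem N (Channel.reservoirSize α N) R ∧
        ∀ x (t : ℝ≥0), R x t = Channel.rho (P N) (X N) x t := fun N => by
    by_cases hN : 1 ≤ N
    · obtain ⟨R, h⟩ := (hX N hN).exists_densitySystem hN (Channel.reservoirSize_pos hα hN)
      exact ⟨R, fun _ => h⟩
    · exact ⟨fun _ _ => 0, fun h => absurd h hN⟩
  choose R hRall using hex
  have hR := fun N hN => (hRall N hN).1
  have hrho := fun N hN => (hRall N hN).2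
  have hM : ∀ N, 1 ≤ N → (0 : ℝ) < (Channel.reservoirSize α N : ℝ) := fun N hN => by
    exact_mod_cast Channel.reservoirSize_pos hα hN
  have hinit : ∀ N x, x < N → R N (x + 1) 0 = u₀ (((x : ℝ) + 1) / N) := fun N x hx => by
    have h1 := hrho N (by omega) (x + 1) 0
    rw [NNReal.coe_zero, hInit N (x + 1) (by omega) (by omega)] at h1
    rw [h1]
    push_cast
    rfl
  have hl : Tendsto (fun N => R N 0 0) atTop (𝓝 vMinus) := by
    refine Channel.tendsto_of_tendsto_in_probability hvMinus (fun N => P N)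
      (fun N ω => Channel.eta (X N 0 ω) 0) ?_ ?_ ?_
    · filter_upwards [eventually_ge_atTop 1] with N hN
      exact ⟨Channel.measurable_eta_comp ((hX N hN).measurable 0) 0,
        fun ω => Channel.eta_mem_Icc (Channel.reservoirSize_pos hα hN) _ _⟩
    · simpa only [Channel.eta_zero] using hInitMinus
    · filter_upwards [eventually_ge_atTop 1] with N hN
      exact (hrho N hN 0 0).symm
  have hr : Tendsto (fun N => R N (N + 1) 0) atTop (𝓝 vPlus) := by
    refine Channel.tendsto_of_tendsto_in_probability hvPlus (fun N => P N)
      (fun N ω => Channel.eta (X N 0 ω) (N + 1)) ?_ ?_ ?_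
    · filter_upwards [eventually_ge_atTop 1] with N hN
      exact ⟨Channel.measurable_eta_comp ((hX N hN).measurable 0) _,
        fun ω => Channel.eta_mem_Icc (Channel.reservoirSize_pos hα hN) _ _⟩
    · simpa only [Channel.eta_right] using hInitPlus
    · filter_upwards [eventually_ge_atTop 1] with N hN
      exact (hrho N hN (N + 1) 0).symm
  have hcur : ∀ t : ℝ, 0 ≤ t → Tendsto (fun N : ℕ =>
      ((N : ℝ) + (N : ℝ) ^ 2 * t / (2 * (N + 1))) / Channel.reservoirSize α N) atTop (𝓝 0) :=
    fun t ht => by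
      simpa using Channel.tendsto_current_div_reservoirSize hα le_rfl hα ht
  have htransfer : ∀ (x : ℕ → ℕ) (s : ℕ → ℝ≥0) (ℓ : ℝ),
      Tendsto (fun N => R N (x N) (s N)) atTop (𝓝 ℓ) →
      Tendsto (fun N => Channel.rho (P N) (X N) (x N) (s N)) atTop (𝓝 ℓ) := fun x s ℓ h => by
    refine h.congr' ?_
    filter_upwards [eventually_ge_atTop 1] with N hN
    exact hrho N hN _ _
  have hdiff : ∀ r ∈ Set.Icc (0 : ℝ) 1, ∀ t > 0, Tendsto
      (fun N : ℕ => R N ⌊(N : ℝ) * r⌋₊ ((N : ℝ) ^ 2 * t)) atTop (𝓝 ((vPlus - vMinus) * r + vMinus +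
        Channel.heatSeries (Channel.limitCoeff u₀ vMinus vPlus) Real.sin r t)) :=
    fun r hr01 t ht => Channel.tendsto_density_diffusive hu₀ hvMinus hvPlus hM hR hinit hl hr ht
      (hcur t ht.le) hr01
  have hsol : Channel.IsHeatSolution u₀ vMinus vPlus fun r t => (vPlus - vMinus) * r + vMinus +
      Channel.heatSeries (Channel.limitCoeff u₀ vMinus vPlus) Real.sin r t := by
    refine Channel.isHeatSolution_heatSeries
      (Channel.polyBounded_limitCoeff hu₀ hvMinus hvPlus hR hinit) ⟨1, fun r hr01 t ht => ?_⟩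
      fun r hr01 => Channel.tendsto_initial hu₀ hu₀_mem hR hinit hr01
        fun t ht => hdiff r (Set.Ioo_subset_Icc_self hr01) t ht
    refine le_of_tendsto (hdiff r hr01 t ht).abs ?_
    filter_upwards [eventually_ge_atTop 1] with N hN
    obtain ⟨h0, h1⟩ := (hR N hN).mem_Icc ⌊(N : ℝ) * r⌋₊ ((N : ℝ) ^ 2 * t) (by positivity)
    rw [abs_le]
    constructor <;> linarith
  refine ⟨⟨⟨_, hsol, fun w hw => hsol.unique hw, fun r hr01 t ht => ?_⟩, fun t ht => ?_⟩,
    fun α' hα' hα'α t ht => ?_⟩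
  · refine htransfer _ (fun N => (N : ℝ≥0) ^ 2 * t) _ ?_
    simpa using hdiff r hr01 t (by exact_mod_cast ht)
  · have h := Channel.tendsto_reservoirs hM hR hl hr (s := fun N => (N : ℝ) ^ 2 * t)
      (fun N => by positivity) (hcur t t.2)
    exact ⟨htransfer (fun _ => 0) (fun N => (N : ℝ≥0) ^ 2 * t) _ (by simpa using h.1),
      htransfer (fun N => N + 1) (fun N => (N : ℝ≥0) ^ 2 * t) _ (by simpa using h.2)⟩
  · have ht' : (0 : ℝ) < t := by exact_mod_cast ht
    have hs : ∀ N : ℕ, 0 ≤ (N : ℝ) ^ (2 + α') * (t : ℝ) := fun N => by positivity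
    have hcur' := Channel.tendsto_current_div_reservoirSize hα hα'.le hα'α ht'.le
    have h := Channel.tendsto_reservoirs hM hR hl hr hs hcur'
    refine ⟨fun r hr01 => htransfer _ (fun N => (N : ℝ≥0) ^ (2 + α') * t) _ ?_,
      htransfer (fun _ => 0) (fun N => (N : ℝ≥0) ^ (2 + α') * t) _ (by simpa using h.1),
      htransfer (fun N => N + 1) (fun N => (N : ℝ≥0) ^ (2 + α') * t) _ (by simpa using h.2)⟩
    simpa using Channel.tendsto_density_superdiffusive hvMinus hvPlus hM hR hl hr hs
      (Channel.tendsto_rpow_mul_div_sq hα' ht') hcur' hr01
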